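/- Let $p\ge 2$ be even, $q\ge 2$, $m=pq$, and let $H=G(m,p,2)\subseteq G=G(m,1,2)$ be the group of matrices $PD\in GL_2(\mathbb C)$ with $P$ a permutation matrix and $D$ a diagonal matrix whose entries are $m$-th roots of unity with $\det(D)^{q}=1$. It acts on $S=\mathbb C[x,y]=\mathrm{Sym}(\mathbb C^2)$ by linear substitutions; put $R=S^H$, and let $$z=\prod_{L}\alpha_L,\qquad \Delta=\prod_L\alpha_L^{e_L},$$ where $L$ runs over the reflecting hyperplanes of $H$, $\alpha_L$ is a (fixed) defining linear form of $L$, and $e_L$ is the order of the pointwise stabiliser of $L$ in $H$. For an irreducible representation $\chi$ of $H$ let $S_\chi\subseteq S$ be the isotypical component of type $\chi$, and $M_\chi=\mathrm{Coker}\bigl(z\colon S_\chi\to S_{\chi\otimes\det}\bigr)$, which maps to $S/(z)$ via the inclusion $S_{\chi\otimes\det}\subseteq S$. For $0\le a,b<m$, $a\ne b$, let $\langle a,b\rangle$ be the restriction to $H$ of the $2$-dimensional representation of $G$ given by the $m$-tuple of Young diagrams with one box in position $a$ and one box in position $b$: in the basis of standard tableaux, $\mathrm{diag}(u,v)$ acts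 by $\mathrm{diag}(u^av^b,u^bv^a)$ and the transposition swaps the two basis vectors. **Theorem.** (a) The ring $R$ is the polynomial ring $\mathbb C[\sigma_1,\sigma_2]$ with $\sigma_1=(xy)^q$, $\sigma_2=x^m+y^m$; the discriminant $\Delta$ lies in $R$ and equals $\sigma_1(\sigma_2^2-4\sigma_1^p)$ up to a non-zero constant. As a power series in $\sigma_1,\sigma_2$ it defines a $D_{p+2}$ singularity, that is, up to a formal change of coordinates and a unit it is $X^2Y+Y^{p+1}$. (b) Over $R/(\Delta)$ let $X_j$, $K_j$, $N_j$ be the cokernels of $$\begin{pmatrix}\sigma_2&2\sigma_1^{j}\\2\sigma_1^{p+1-j}&\sigma_1\sigma_2\end{pmatrix},\quad \begin{pmatrix}\sigma_2&2\sigma_1^{j}\\2\sigma_1^{p-j}&\sigma_2\end{pmatrix},\quad \begin{pmatrix}\sigma_1\sigma_2&-2\sigma_1^{j+1}\\-2\sigma_1^{p+1-j}&\sigma_1\sigma_2\end{pmatrix}$$ acting on column vectors, for $0\le j\le p$. These are Cohen–Macaulay modules over $R/(\Delta)$ (at every prime $P$ the localisation is zero or has depth $\dim (R/(\Delta))_P$).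 (c) In each of the following cases the $2$-dimensional representation of $H$ is irreducible, the map $M_\chi\to S/(z)$ is a split injection of $R$-modules, so that $M_\chi$ is a direct summand of $S/(z)$, and there is an isomorphism of $R$-modules (equivalently, of $R/(\Delta)$-modules): 1. $M_{\langle i,\,jq-1\rangle}\cong X_{p+1-j}^2$ for $1\le j\le p$ and $0\le i<q-1$; 2. $M_{\langle i,\,jq+r\rangle}\cong K_j^2$ for $0\le j\le p-1$, $j\ne p/2$, $0\le i,r<q-1$ and $i<jq+r$ (in particular $M_{\langle 0,\,jq\rangle}\cong K_j^2$ for $1\le j\le p-1$, $j\neq p/2$); 3. $M_{\langle q-1,\,(j+1)q-1\rangle}\cong N_j^2$ for $1\le j\le p-1$, $j\ne p/2$. -/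

import Mathlib

namespace ReflectionMCM

open MvPolynomial

/-! ### The group `G(m,p,n)` -/

/-- The complex reflection group `G(m,p,n)`: the matrices `P D`, where `P` is the permutation
matrix of `s` (so `P e_j = e_{s j}`) and `D = diag(d_1, …, d_n)` with `d_j ^ m = 1` for all `j` and
`det(D)^(m/p) = 1`. -/
def imprimitiveGroup (m p n : ℕ) : Subgroup (GL (Fin n) ℂ) where
  carrier := {g | ∃ (s : Equiv.Perm (Fin n)) (d : Fin n → ℂˣ),
    (∀ j, d j ^ m = 1) ∧ (∏ j, d j) ^ (m / p) = 1 ∧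
    ∀ i j, (g : Matrix (Fin n) (Fin n) ℂ) i j = if i = s j then (d j : ℂ) else 0}
  one_mem' := by
    refine ⟨1, 1, by simp, by simp, fun i j => ?_⟩
    rw [Units.val_one, Matrix.one_apply]
    exact ite_congr rfl (fun _ => rfl) (fun _ => rfl)
  mul_mem' := by
    rintro g h ⟨s, d, hd, hD, hg⟩ ⟨t, e, he, hE, hh⟩
    refine ⟨s * t, fun j => d (t j) * e j, fun j => by rw [mul_pow, hd, he, one_mul], ?_, ?_⟩
    · rw [Finset.prod_mul_distrib, Equiv.prod_comp t d, mul_pow, hD, hE, one_mul]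
    · intro i j
      have h1 : ((g * h : GL (Fin n) ℂ) : Matrix (Fin n) (Fin n) ℂ) i j =
          if i = s (t j) then (d (t j) : ℂ) * (e j : ℂ) else 0 := by
        simp [Matrix.mul_apply, hg, hh]
      rw [h1, Units.val_mul]
      exact ite_congr rfl (fun _ => rfl) (fun _ => rfl)
  inv_mem' := by
    rintro g ⟨s, d, hd, hD, hg⟩
    refine ⟨s⁻¹, fun j => (d (s⁻¹ j))⁻¹, fun j => by rw [inv_pow, hd, inv_one], ?_, ?_⟩
    · rw [Finset.prod_inv_distrib, Equiv.prod_comp s⁻¹ d, inv_pow, hD, inv_one]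
    · have key : (Matrix.of fun i j => if i = s⁻¹ j then (((d (s⁻¹ j))⁻¹ : ℂˣ) : ℂ) else 0) *
          (g : Matrix (Fin n) (Fin n) ℂ) = 1 := by
        ext i j
        simp [Matrix.mul_apply, hg, Matrix.one_apply]
      have h2 : ((g⁻¹ : GL (Fin n) ℂ) : Matrix (Fin n) (Fin n) ℂ) =
          Matrix.of fun i j => if i = s⁻¹ j then (((d (s⁻¹ j))⁻¹ : ℂˣ) : ℂ) else 0 := by
        rw [Matrix.coe_units_inv]
        exact Matrix.inv_eq_left_inv key
      intro i j
      rw [h2]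
      rfl

lemma imprimitiveGroup_le (m p n : ℕ) : imprimitiveGroup m p n ≤ imprimitiveGroup m 1 n := by
  rintro g ⟨s, d, hd, -, hg⟩
  refine ⟨s, d, hd, ?_, hg⟩
  rw [Nat.div_one, ← Finset.prod_pow]
  exact Finset.prod_eq_one fun j _ => hd j

/-! ### The action on the polynomial ring and the ring of invariants -/

/-- The action of a matrix `g` on `S = Sym(ℂⁿ) = ℂ[x_1, …, x_n]`, where `x_j` is the `j`-th standard
basis vector of `ℂⁿ`: the algebra map with `x_j ↦ g x_j = ∑ i, g_{ij} x_i`. -/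
noncomputable def linSubst {n : ℕ} (g : GL (Fin n) ℂ) :
    MvPolynomial (Fin n) ℂ →ₐ[ℂ] MvPolynomial (Fin n) ℂ :=
  aeval fun j => ∑ i, C ((g : Matrix (Fin n) (Fin n) ℂ) i j) * X i

/-- The representation of `G ⊆ GL_n(ℂ)` on `S = Sym(ℂⁿ)`. -/
noncomputable def symRep {n : ℕ} (G : Subgroup (GL (Fin n) ℂ)) :
    Representation ℂ G (MvPolynomial (Fin n) ℂ) where
  toFun g := (linSubst (g : GL (Fin n) ℂ)).toLinearMap
  map_one' := by
    have : linSubst (1 : GL (Fin n) ℂ) = AlgHom.id ℂ _ := by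
      refine MvPolynomial.algHom_ext fun j => ?_
      simp [linSubst, Matrix.one_apply]
    refine LinearMap.ext fun f => ?_
    change linSubst (1 : GL (Fin n) ℂ) f = f
    rw [this]
    rfl
  map_mul' g h := by
    have : linSubst ((g * h : G) : GL (Fin n) ℂ) =
        (linSubst (g : GL (Fin n) ℂ)).comp (linSubst (h : GL (Fin n) ℂ)) := by
      refine MvPolynomial.algHom_ext fun j => ?_
      simp only [linSubst, aeval_X, AlgHom.comp_apply, map_sum, map_mul, Subgroup.coe_mul,
        Units.val_mul, Matrix.mul_apply, algHom_C, Finset.mul_sum, Finset.sum_mul]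
      rw [Finset.sum_comm]
      refine Finset.sum_congr rfl fun i _ => Finset.sum_congr rfl fun k _ => ?_
      simp only [algebraMap_eq]
      ring
    rw [this]
    rfl

/-- The invariant ring `R = S^G`, as a subalgebra of `S`. -/
noncomputable def invariantSubalgebra {n : ℕ} (G : Subgroup (GL (Fin n) ℂ)) :
    Subalgebra ℂ (MvPolynomial (Fin n) ℂ) where
  carrier := {f | ∀ g : G, symRep G g f = f}
  mul_mem' := by
    intro a b ha hb g
    have h : symRep G g (a * b) = symRep G g a * symRep G g b :=
      map_mul (linSubst (g : GL (Fin n) ℂ)) a b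
    rw [h, ha g, hb g]
  add_mem' := by
    intro a b ha hb g
    rw [map_add, ha g, hb g]
  algebraMap_mem' := fun r g => (linSubst (g : GL (Fin n) ℂ)).commutes r

/-- The invariant ring `R = S^G`, as a type of its own (which keeps instance search fast). -/
def InvRing {n : ℕ} (G : Subgroup (GL (Fin n) ℂ)) : Type := invariantSubalgebra G

namespace InvRing

variable {n : ℕ} (G : Subgroup (GL (Fin n) ℂ))

noncomputable instance : CommRing (InvRing G) :=
  inferInstanceAs (CommRing (invariantSubalgebra G))

noncomputable instance : Algebra ℂ (InvRing G) :=
  inferInstanceAs (Algebra ℂ (invariantSubalgebra G))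

noncomputable instance : Algebra (InvRing G) (MvPolynomial (Fin n) ℂ) :=
  inferInstanceAs (Algebra (invariantSubalgebra G) (MvPolynomial (Fin n) ℂ))

instance : IsScalarTower ℂ (InvRing G) (MvPolynomial (Fin n) ℂ) :=
  inferInstanceAs (IsScalarTower ℂ (invariantSubalgebra G) (MvPolynomial (Fin n) ℂ))

/-- The inclusion `R ⊆ S`. -/
noncomputable def incl : InvRing G →ₐ[ℂ] MvPolynomial (Fin n) ℂ := (invariantSubalgebra G).val

end InvRing

/-! ### Reflection arrangement, `z` and the discriminant

`S = Sym(V)` is the ring of polynomial functions on `V^*`; we write the points of `V^*` as row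
vectors, on which `g` acts by `v ↦ v g`, so that `(g f)(v) = f(v g)`. -/

/-- The reflecting hyperplanes `A(G)`: the hyperplanes that are the fixed space of some `g ∈ G`. -/
def reflectingHyperplanes {n : ℕ} (G : Subgroup (GL (Fin n) ℂ)) :
    Set (Submodule ℂ (Fin n → ℂ)) :=
  {H | Module.finrank ℂ H + 1 = n ∧ ∃ g ∈ G, ∀ v : Fin n → ℂ,
    v ∈ H ↔ Matrix.vecMul v (g : Matrix (Fin n) (Fin n) ℂ) = v}

/-- `e_H`: the order of the subgroup of `G` that fixes `H` pointwise. -/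
noncomputable def fixerOrder {n : ℕ} (G : Subgroup (GL (Fin n) ℂ))
    (H : Submodule ℂ (Fin n → ℂ)) : ℕ :=
  Nat.card {g : GL (Fin n) ℂ //
    g ∈ G ∧ ∀ v ∈ H, Matrix.vecMul v (g : Matrix (Fin n) (Fin n) ℂ) = v}

/-- `f ∈ S` is a defining linear equation of the hyperplane `H`. -/
def IsDefiningForm {n : ℕ} (H : Submodule ℂ (Fin n → ℂ)) (f : MvPolynomial (Fin n) ℂ) : Prop :=
  (∃ a : Fin n → ℂ, f = ∑ i, C (a i) * X i) ∧ ∀ v : Fin n → ℂ, v ∈ H ↔ eval v f = 0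

/-- `z = ∏_{H ∈ A(G)} α_H`, the equation of the reduced hyperplane arrangement. -/
noncomputable def arrangementPoly {n : ℕ} (G : Subgroup (GL (Fin n) ℂ))
    (α : Submodule ℂ (Fin n → ℂ) → MvPolynomial (Fin n) ℂ) : MvPolynomial (Fin n) ℂ :=
  ∏ᶠ H ∈ reflectingHyperplanes G, α H

/-- The discriminant `∏_{H ∈ A(G)} α_H ^ e_H` of the group action. -/
noncomputable def discriminantPoly {n : ℕ} (G : Subgroup (GL (Fin n) ℂ))
    (α : Submodule ℂ (Fin n → ℂ) → MvPolynomial (Fin n) ℂ) : MvPolynomial (Fin n) ℂ :=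
  ∏ᶠ H ∈ reflectingHyperplanes G, α H ^ fixerOrder G H

/-! ### Isotypical components and the modules `M_χ` -/

section Isotypic

variable {n : ℕ} (G : Subgroup (GL (Fin n) ℂ)) {W : Type} [AddCommGroup W] [Module ℂ W]

/-- The isotypical component `S^G_χ` of `S` for an irreducible representation `ρ` with character
`χ`, as an `R`-submodule of `S`. It is the sum of the images of all `G`-equivariant maps `ρ → S`; as
`ρ` is irreducible, these images are `0` and the subrepresentations of `S` isomorphic to `ρ`. -/
noncomputable def isotypic (ρ : Representation ℂ G W) :
    Submodule (InvRing G) (MvPolynomial (Fin n) ℂ) where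
  carrier := ((⨆ f : Representation.IntertwiningMap ρ (symRep G), LinearMap.range f.toLinearMap :
    Submodule ℂ (MvPolynomial (Fin n) ℂ)) : Set (MvPolynomial (Fin n) ℂ))
  add_mem' := fun ha hb => Submodule.add_mem _ ha hb
  zero_mem' := Submodule.zero_mem _
  smul_mem' := by
    intro r x hx
    have h : (⨆ f : Representation.IntertwiningMap ρ (symRep G),
        LinearMap.range f.toLinearMap) ≤
        (⨆ f : Representation.IntertwiningMap ρ (symRep G),
          LinearMap.range f.toLinearMap).comap
          (LinearMap.mulLeft ℂ (InvRing.incl G r)) := by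
      refine iSup_le fun f => ?_
      rintro _ ⟨w, rfl⟩
      let f' : Representation.IntertwiningMap ρ (symRep G) :=
        ⟨(LinearMap.mulLeft ℂ (InvRing.incl G r)).comp f.toLinearMap, by
          intro g
          ext1 v
          have h1 : symRep G g (InvRing.incl G r * f.toLinearMap v) =
              symRep G g (InvRing.incl G r) * symRep G g (f.toLinearMap v) :=
            map_mul (linSubst (g : GL (Fin n) ℂ)) _ _
          have h2 : f.toLinearMap (ρ g v) = symRep G g (f.toLinearMap v) :=
            LinearMap.congr_fun (f.isIntertwining' g) v
          have h3 : symRep G g (InvRing.incl G r) = InvRing.incl G r := r.2 g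
          change InvRing.incl G r * f.toLinearMap (ρ g v) =
            symRep G g (InvRing.incl G r * f.toLinearMap v)
          rw [h1, h2, h3]⟩
      exact (le_iSup (fun f : Representation.IntertwiningMap ρ (symRep G) =>
        LinearMap.range f.toLinearMap) f') ⟨w, rfl⟩
    exact h hx

/-- The representation `ρ ⊗ det`. -/
noncomputable def detTwist (ρ : Representation ℂ G W) : Representation ℂ G W where
  toFun g := ((g : GL (Fin n) ℂ) : Matrix (Fin n) (Fin n) ℂ).det • ρ g
  map_one' := by simp
  map_mul' g h := by
    simp only [Subgroup.coe_mul, Units.val_mul, Matrix.det_mul, map_mul, smul_mul_smul_comm]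

/-- `M_χ`, the cokernel of the multiplication map `z : S^G_χ → S^G_{χ ⊗ det}`. -/
abbrev MMod (z : MvPolynomial (Fin n) ℂ) (ρ : Representation ℂ G W) : Type :=
  isotypic G (detTwist G ρ) ⧸
    ((isotypic G ρ).map (LinearMap.mulLeft (InvRing G) z)).comap
      (isotypic G (detTwist G ρ)).subtype

/-- The map `M_χ → S/(z)` induced by the inclusion `S^G_{χ ⊗ det} ⊆ S`. -/
noncomputable def MMod.toQuotient (z : MvPolynomial (Fin n) ℂ) (ρ : Representation ℂ G W) :
    MMod G z ρ →ₗ[InvRing G] (MvPolynomial (Fin n) ℂ ⧸ Ideal.span {z}) :=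
  Submodule.liftQ _
    ((Ideal.Quotient.mkₐ (InvRing G) (Ideal.span {z})).toLinearMap.comp
      (isotypic G (detTwist G ρ)).subtype)
    (by
      rintro ⟨x, hx⟩ ⟨y, -, hy⟩
      have hy' : z * y = x := hy
      change Ideal.Quotient.mk (Ideal.span {z}) x = 0
      rw [Ideal.Quotient.eq_zero_iff_mem, ← hy']
      exact Ideal.mul_mem_right _ _ (Ideal.mem_span_singleton_self z))

/-- `ρ` is irreducible, `M_ρ ≅ Q²` as `R`-modules, and `M_ρ → S/(z)` is a split injection of
`R`-modules, so that `M_ρ ≅ Q²` is a direct summand of `S/(z)`. -/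
def GivesSquareSummand (z : MvPolynomial (Fin n) ℂ) (ρ : Representation ℂ G W)
    (Q : Type) [AddCommGroup Q] [Module (InvRing G) Q] : Prop :=
  ρ.IsIrreducible ∧
  Nonempty (MMod G z ρ ≃ₗ[InvRing G] (Q × Q)) ∧
  ∃ π : (MvPolynomial (Fin n) ℂ ⧸ Ideal.span {z}) →ₗ[InvRing G] MMod G z ρ,
    π ∘ₗ MMod.toQuotient G z ρ = LinearMap.id

end Isotypic

/-! ### Two-dimensional representations of `G(m,1,2)` -/

/-- The matrix of `g ∈ G(m,1,2)` on the representation of the `m`-tuple of Young diagrams with one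
box in position `i` and one box in position `j`. The basis vector with index `k : Fin 2` is the
standard tableau with the letter `k + 1` in position `i` and the other letter in position `j`. Thus
`diag(a, b)` acts by `diag(a^i b^j, b^i a^j)`, and the transposition swaps the two tableaux. -/
noncomputable def boxMatrix (i j : ℕ) (g : Matrix (Fin 2) (Fin 2) ℂ) : Matrix (Fin 2) (Fin 2) ℂ :=
  open Classical in
  Matrix.of fun k l => if g k l = 0 then 0 else g k l ^ i * g k.rev l.rev ^ j

lemma boxMatrix_mul (m i j : ℕ) (g h : imprimitiveGroup m 1 2) :
    boxMatrix i j ((g * h : imprimitiveGroup m 1 2) : GL (Fin 2) ℂ) =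
      boxMatrix i j (g : GL (Fin 2) ℂ) * boxMatrix i j (h : GL (Fin 2) ℂ) := by
  obtain ⟨g, s, d, -, -, hg⟩ := g
  obtain ⟨h, t, e, -, -, hh⟩ := h
  have key : ∀ s : Equiv.Perm (Fin 2), s = 1 ∨ s = Equiv.swap 0 1 := by decide
  ext k l
  simp only [boxMatrix, Matrix.mul_apply, Matrix.of_apply, Subgroup.coe_mul, Units.val_mul, hg, hh,
    Fin.sum_univ_two]
  rcases key s with rfl | rfl <;> rcases key t with rfl | rfl <;> fin_cases k <;> fin_cases l <;>
    simp <;> ring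

/-- The representation of `G(m,1,2)` on the space of standard tableaux of the `m`-tuple of Young
diagrams with one box in position `i` and one box in position `j`. -/
noncomputable def boxRep (m i j : ℕ) :
    Representation ℂ (imprimitiveGroup m 1 2) (Fin 2 → ℂ) where
  toFun g := Matrix.toLin' (boxMatrix i j (g : GL (Fin 2) ℂ))
  map_one' := by
    have : boxMatrix i j (1 : Matrix (Fin 2) (Fin 2) ℂ) = 1 := by
      ext k l
      fin_cases k <;> fin_cases l <;> simp [boxMatrix]
    refine LinearMap.ext fun f => ?_
    simp [this]
  map_mul' g h := by
    rw [boxMatrix_mul, Matrix.toLin'_mul]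
    rfl

/-- The restriction of `boxRep m i j` to `G(m,p,2)`. -/
noncomputable def resBoxRep (m p i j : ℕ) :
    Representation ℂ (imprimitiveGroup m p 2) (Fin 2 → ℂ) :=
  (boxRep m i j).comp (Subgroup.inclusion (imprimitiveGroup_le m p 2))

/-! ### The modules `X_j`, `K_j`, `N_j` -/

section Cokernels

variable {A : Type} [CommRing A]

/-- The cokernel of a square matrix acting on column vectors. -/
abbrev Coker (φ : Matrix (Fin 2) (Fin 2) A) : Type :=
  (Fin 2 → A) ⧸ LinearMap.range φ.mulVecLin

/-- The matrix `ξ_j`. Here and below `s`, `t` stand for `σ₁`, `σ₂`. -/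
def xiMat (p : ℕ) (s t : A) (j : ℕ) : Matrix (Fin 2) (Fin 2) A :=
  !![t, 2 * s ^ j; 2 * s ^ (p + 1 - j), t * s]

/-- The matrix `φ_j`. -/
def phiMat (p : ℕ) (s t : A) (j : ℕ) : Matrix (Fin 2) (Fin 2) A :=
  !![t, 2 * s ^ j; 2 * s ^ (p - j), t]

/-- The matrix `ψ_j`. -/
def psiMat (p : ℕ) (s t : A) (j : ℕ) : Matrix (Fin 2) (Fin 2) A :=
  !![t * s, -2 * s ^ (j + 1); -2 * s ^ (p + 1 - j), t * s]

/-- `X_j = Coker ξ_j`. For `s = σ₁`, `t = σ₂` in `A = R/(Δ)` this is also the cokernel of `ξ_j` over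
`R`, because the latter is annihilated by `Δ`; similarly for `K_j` and `N_j`. -/
abbrev XMod (p : ℕ) (s t : A) (j : ℕ) : Type := Coker (xiMat p s t j)

/-- `K_j = Coker φ_j`. -/
abbrev KMod (p : ℕ) (s t : A) (j : ℕ) : Type := Coker (phiMat p s t j)

/-- `N_j = Coker ψ_j`. -/
abbrev NMod (p : ℕ) (s t : A) (j : ℕ) : Type := Coker (psiMat p s t j)

end Cokernels

/-! ### Cohen-Macaulay modules and `D_n` singularities -/

/-- (Maximal) Cohen-Macaulay modules over a Noetherian ring `A`: finitely generated, with
`depth M_P = dim A_P` for every prime `P` with `M_P ≠ 0`. Since `depth M_P ≤ dim A_P` if `M_P ≠ 0`,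
it is enough to ask for a weakly regular sequence of length `dim A_P` in the maximal ideal; by
Nakayama it is regular if `M_P ≠ 0`, and it always exists if `M_P = 0`. -/
def IsCohenMacaulayModule (A M : Type) [CommRing A] [AddCommGroup M] [Module A M] : Prop :=
  Module.Finite A M ∧ ∀ (P : Ideal A) [P.IsPrime],
    ∃ rs : List (Localization.AtPrime P),
      (∀ r ∈ rs, r ∈ IsLocalRing.maximalIdeal (Localization.AtPrime P)) ∧
      RingTheory.Sequence.IsWeaklyRegular (LocalizedModule P.primeCompl M) rs ∧
      (rs.length : WithBot ℕ∞) = ringKrullDim (Localization.AtPrime P)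

/-- The plane curve germ `f = 0` is a `D_n` singularity (`n ≥ 4`): up to a formal change of
coordinates and a unit, `f` is `X² Y + Y^(n-1)`. -/
def IsDSingularity (n : ℕ) (f : MvPowerSeries (Fin 2) ℂ) : Prop :=
  4 ≤ n ∧ ∃ (e : MvPowerSeries (Fin 2) ℂ ≃ₐ[ℂ] MvPowerSeries (Fin 2) ℂ)
    (u : (MvPowerSeries (Fin 2) ℂ)ˣ),
    e f = (u : MvPowerSeries (Fin 2) ℂ) * (MvPowerSeries.X 0 ^ 2 * MvPowerSeries.X 1 + MvPowerSeries.X 1 ^ (n - 1))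

end ReflectionMCM

open ReflectionMCM MvPolynomial

/-!
For a point `(u, v)` of the diagonal torus of `H` (`m`-th roots of unity with `(uv) ^ q = 1`) the
monomial `x ^ k y ^ l` is multiplied by `u ^ k v ^ l`, so `S` is graded by the character group of
the torus, and the coordinate swap `τ` exchanges the degrees of `(k, l)` and `(l, k)`. Since
`⟨a, b⟩` is induced from the torus character `(a, b)`, it is irreducible as soon as `(a, b)` and
`(b, a)` have distinct degrees, and its isotypical component is then the sum of the two weight
spaces `S_(a, b) ⊕ τ S_(a, b)`. Projecting onto weight spaces splits `M_⟨a, b⟩ → S/(z)`. Moreover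
`z` is a weight vector of the same weight `(1, 1)` as `xy`, with `τ z = -z`, so `M_⟨a, b⟩` is two
copies of the cokernel of `z : S_(a, b) → S_(a + 1, b + 1)`.

Each weight space is free over `R` on two monomials, and the matrices of `z` in such bases are the
matrices `ξ`, `φ`, `ψ`. Each of them is one half of a matrix factorization of `Δ`. Over a domain of
dimension at most two this makes the cokernel Cohen-Macaulay over `R/(Δ)`: every nonzerodivisor of
`R/(Δ)` is regular on it, and `R/(Δ)` has dimension at most one.
-/

namespace ReflectionMCM

local notation "S" => MvPolynomial (Fin 2) ℂ

section MatrixFactorization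

variable {R n : Type*} [CommRing R] [Fintype n] [DecidableEq n] {D : R} {φ ψ : Matrix n n R}

/-- Matrix factorizations `(φ, ψ)` of a scalar `D`, the presentations through which the cokernels
over `R/(D)` embed in free modules. -/
structure IsMatrixFactorization (D : R) (φ ψ : Matrix n n R) : Prop where
  mul_eq : φ * ψ = D • 1
  mul_eq' : ψ * φ = D • 1

theorem isMatrixFactorization_adjugate (φ : Matrix n n R) :
    IsMatrixFactorization φ.det φ φ.adjugate :=
  ⟨φ.mul_adjugate, φ.adjugate_mul⟩

namespace IsMatrixFactorization

theorem symm (h : IsMatrixFactorization D φ ψ) : IsMatrixFactorization D ψ φ :=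
  ⟨h.mul_eq', h.mul_eq⟩

theorem smul_right (h : IsMatrixFactorization D φ ψ) (c : R) :
    IsMatrixFactorization (c * D) φ (c • ψ) :=
  ⟨by rw [mul_smul_comm, h.mul_eq, smul_smul], by rw [smul_mul_assoc, h.mul_eq', smul_smul]⟩

theorem exists_of_dvd {D' : R} (h : IsMatrixFactorization D φ ψ) (hD : D ∣ D') :
    ∃ ψ', IsMatrixFactorization D' φ ψ' := by
  obtain ⟨c, rfl⟩ := hD
  exact ⟨c • ψ, mul_comm D c ▸ h.smul_right c⟩

theorem map_mul_map_eq_zero (h : IsMatrixFactorization D φ ψ) :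
    φ.map (Ideal.Quotient.mk (Ideal.span {D})) *
      ψ.map (Ideal.Quotient.mk (Ideal.span {D})) = 0 := by
  rw [← Matrix.map_mul, h.mul_eq]
  ext i j
  rw [Matrix.map_apply, Matrix.smul_apply, smul_eq_mul, map_mul, Ideal.Quotient.mk_singleton_self,
    zero_mul, Matrix.zero_apply]

theorem eq_mulVec_of_mulVec_eq_smul (h : IsMatrixFactorization D φ ψ) (hD : D ∈ nonZeroDivisors R)
    {v w : n → R} (hv : ψ.mulVec v = D • w) : v = φ.mulVec w := by
  have hDv : D • v = D • φ.mulVec w := by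
    rw [← Matrix.mulVec_smul, ← hv, Matrix.mulVec_mulVec, h.mul_eq, Matrix.smul_mulVec,
      Matrix.one_mulVec]
  exact funext fun i => (mul_cancel_left_mem_nonZeroDivisors hD).1 (congrFun hDv i)

theorem range_eq_ker (h : IsMatrixFactorization D φ ψ) (hD : D ∈ nonZeroDivisors R) :
    LinearMap.range (φ.map (Ideal.Quotient.mk (Ideal.span {D}))).mulVecLin =
      LinearMap.ker (ψ.map (Ideal.Quotient.mk (Ideal.span {D}))).mulVecLin := by
  set π := Ideal.Quotient.mk (Ideal.span {D})
  refine le_antisymm ?_ fun v hv => ?_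
  · rw [LinearMap.range_le_ker_iff, ← Matrix.mulVecLin_mul, h.symm.map_mul_map_eq_zero,
      Matrix.mulVecLin_zero]
  obtain ⟨u, rfl⟩ : ∃ u : n → R, π ∘ u = v := Ideal.Quotient.mk_surjective.comp_left v
  have hdvd (i : n) : D ∣ ψ.mulVec u i := by
    rw [← Ideal.Quotient.eq_zero_iff_dvd, RingHom.map_mulVec]
    exact congrFun hv i
  choose w hw using hdvd
  refine ⟨π ∘ w, _root_.funext fun i => ?_⟩
  rw [h.eq_mulVec_of_mulVec_eq_smul hD (_root_.funext hw), Function.comp_apply, RingHom.map_mulVec,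
    Matrix.mulVecLin_apply]

theorem isSMulRegular_coker (h : IsMatrixFactorization D φ ψ) (hD : D ∈ nonZeroDivisors R)
    {r : R ⧸ Ideal.span {D}} (hr : r ∈ nonZeroDivisors (R ⧸ Ideal.span {D})) :
    IsSMulRegular ((n → R ⧸ Ideal.span {D}) ⧸
      LinearMap.range (φ.map (Ideal.Quotient.mk (Ideal.span {D}))).mulVecLin) r := by
  rw [isSMulRegular_iff_right_eq_zero_of_smul]
  intro x hx
  obtain ⟨v, rfl⟩ := Submodule.Quotient.mk_surjective _ x
  rw [← Submodule.Quotient.mk_smul, Submodule.Quotient.mk_eq_zero, h.range_eq_ker hD,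
    LinearMap.mem_ker, map_smul] at hx
  rw [Submodule.Quotient.mk_eq_zero, h.range_eq_ker hD]
  exact _root_.funext fun i => (mul_left_mem_nonZeroDivisors_eq_zero_iff hr).1 (congrFun hx i)

end IsMatrixFactorization

end MatrixFactorization

section CohenMacaulay

theorem eq_of_isPrime_of_le_span_singleton {R : Type*} [CommRing R]
    [IsDomain R] [UniqueFactorizationMonoid R] {f : R} (hf : Prime f) {Q : Ideal R} [Q.IsPrime]
    (hQ : Q ≠ ⊥) (hle : Q ≤ Ideal.span {f}) : Q = Ideal.span {f} := by
  obtain ⟨g, hgQ, hg⟩ := Ideal.IsPrime.exists_mem_prime_of_ne_bot ‹_› hQ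
  have hgf : Associated f g := hf.associated_of_dvd hg (Ideal.mem_span_singleton.1 (hle hgQ))
  rw [Ideal.span_singleton_eq_span_singleton.2 hgf] at hle ⊢
  exact hle.antisymm ((Ideal.span_singleton_le_iff_mem Q).2 hgQ)

theorem height_le_one_of_ringKrullDim_le_two {R : Type*} [CommRing R] [IsDomain R] {D : R}
    (hdim : ringKrullDim R ≤ 2) (hD : D ≠ 0)
    (P : Ideal (R ⧸ Ideal.span {D})) [P.IsPrime] : P.height ≤ 1 := by
  have hle : (P.height : WithBot ℕ∞) + 1 ≤ 2 :=
    (add_le_add_left Ideal.height_le_ringKrullDim_of_isPrime 1).trans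
      ((ringKrullDim_quotient_succ_le_of_nonZeroDivisor
        (mem_nonZeroDivisors_of_ne_zero hD)).trans hdim)
  rw [← one_add_one_eq_two] at hle
  exact (ENat.add_le_add_iff_right ENat.one_ne_top).1 (WithBot.coe_le_coe.1 hle)

variable {R : Type*} [CommRing R] [IsDomain R] [UniqueFactorizationMonoid R] {D : R}

theorem exists_mem_factors_dvd_of_mk_notMem_nonZeroDivisors (hD : D ≠ 0) {r : R}
    (hr : Ideal.Quotient.mk (Ideal.span {D}) r ∉ nonZeroDivisors (R ⧸ Ideal.span {D})) :
    ∃ f ∈ UniqueFactorizationMonoid.factors D, f ∣ r := by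
  contrapose! hr
  rw [mem_nonZeroDivisors_iff_right]
  intro x hx
  obtain ⟨x, rfl⟩ := Ideal.Quotient.mk_surjective x
  rw [← map_mul, Ideal.Quotient.eq_zero_iff_dvd] at hx
  rw [Ideal.Quotient.eq_zero_iff_dvd]
  refine UniqueFactorizationMonoid.dvd_of_dvd_mul_left_of_no_prime_factors hD ?_ hx
  intro d hdD hdr hd
  obtain ⟨f, hf, hdf⟩ := UniqueFactorizationMonoid.exists_mem_factors_of_dvd hD hd.irreducible hdD
  exact hr f hf (hdf.dvd_iff_dvd_left.1 hdr)

theorem exists_mem_factors_comap_le_span (hD : D ≠ 0) {P : Ideal (R ⧸ Ideal.span {D})}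
    (hP : ∀ r ∈ P, r ∉ nonZeroDivisors (R ⧸ Ideal.span {D})) :
    ∃ f ∈ UniqueFactorizationMonoid.factors D,
      P.comap (Ideal.Quotient.mk (Ideal.span {D})) ≤ Ideal.span {f} := by
  classical
  have hsub : ((P.comap (Ideal.Quotient.mk (Ideal.span {D})) : Ideal R) : Set R) ⊆
      ⋃ f ∈ ((UniqueFactorizationMonoid.factors D).toFinset : Set R),
        ((Ideal.span {f} : Ideal R) : Set R) := by
    intro r hr
    obtain ⟨f, hf, hfr⟩ := exists_mem_factors_dvd_of_mk_notMem_nonZeroDivisors hD (hP _ hr)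
    simp only [Set.mem_iUnion]
    exact ⟨f, by simpa using hf, Ideal.mem_span_singleton.2 hfr⟩
  obtain ⟨f, hf, hle⟩ := (Ideal.subset_union_prime 0 0 fun f hf _ _ => by
    have := UniqueFactorizationMonoid.prime_of_factor f (by simpa using hf)
    exact (Ideal.span_singleton_prime this.ne_zero).2 this).1 hsub
  exact ⟨f, by simpa using hf, hle⟩

/-- Prime avoidance: a prime ideal of `R/(D)` without non-zero-divisors lies in `(f)/(D)` for some
prime factor `f` of `D`, hence is equal to it. -/
theorem exists_mem_nonZeroDivisors_of_notMem_minimalPrimes (hD : D ≠ 0)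
    (P : Ideal (R ⧸ Ideal.span {D})) [P.IsPrime]
    (hmin : P ∉ minimalPrimes (R ⧸ Ideal.span {D})) :
    ∃ r ∈ P, r ∈ nonZeroDivisors (R ⧸ Ideal.span {D}) := by
  contrapose! hmin
  obtain ⟨f, hf, hle⟩ := exists_mem_factors_comap_le_span hD hmin
  have hcomap (Q : Ideal (R ⧸ Ideal.span {D})) [Q.IsPrime] (hQP : Q ≤ P) :
      Q.comap (Ideal.Quotient.mk (Ideal.span {D})) = Ideal.span {f} := by
    refine eq_of_isPrime_of_le_span_singleton (UniqueFactorizationMonoid.prime_of_factor f hf)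
      (fun hbot => hD ?_) ((Ideal.comap_mono hQP).trans hle)
    rw [← Ideal.mem_bot, ← hbot, Ideal.mem_comap, Ideal.Quotient.mk_singleton_self]
    exact Q.zero_mem
  refine ⟨⟨‹_›, bot_le⟩, fun Q ⟨hQ, _⟩ hQP => ?_⟩
  exact (Ideal.comap_injective_of_surjective _ Ideal.Quotient.mk_surjective
    ((hcomap Q hQP).trans (hcomap P le_rfl).symm)).ge

end CohenMacaulay

theorem IsMatrixFactorization.isCohenMacaulayModule_coker {R : Type} [CommRing R] [IsDomain R]
    [UniqueFactorizationMonoid R] {D : R} {φ ψ : Matrix (Fin 2) (Fin 2) R}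
    (h : IsMatrixFactorization D φ ψ) (hD : D ≠ 0) (hdim : ringKrullDim R ≤ 2) :
    IsCohenMacaulayModule (R ⧸ Ideal.span {D})
      (Coker (φ.map (Ideal.Quotient.mk (Ideal.span {D})))) := by
  refine ⟨inferInstance, fun P hP => ?_⟩
  rw [IsLocalization.AtPrime.ringKrullDim_eq_height P]
  by_cases hmin : P ∈ minimalPrimes (R ⧸ Ideal.span {D})
  · refine ⟨[], by simp, RingTheory.Sequence.IsWeaklyRegular.nil _ _, ?_⟩
    rw [Ideal.height_eq_zero_iff.2 hmin]
    rfl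
  · obtain ⟨r, hrP, hr⟩ := exists_mem_nonZeroDivisors_of_notMem_minimalPrimes hD P hmin
    refine ⟨[algebraMap _ _ r], ?_, ?_, ?_⟩
    · simpa using (IsLocalization.AtPrime.to_map_mem_maximal_iff _ P r).2 hrP
    · rw [RingTheory.Sequence.isWeaklyRegular_singleton_iff]
      exact (h.isSMulRegular_coker (mem_nonZeroDivisors_of_ne_zero hD) hr).of_isLocalizedModule
        _ P.primeCompl (LocalizedModule.mkLinearMap P.primeCompl _)
    · rw [(height_le_one_of_ringKrullDim_le_two hdim hD P).antisymm
        (Order.one_le_iff_ne_zero.2 fun h0 => hmin (Ideal.height_eq_zero_iff.1 h0))]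
      rfl

section DSingularity

/-- The automorphism `X i ↦ a i * X i` of the power series ring, for units `a i`. -/
noncomputable def rescaleEquiv {σ R : Type*} [CommRing R] (a : σ → Rˣ) :
    MvPowerSeries σ R ≃ₐ[R] MvPowerSeries σ R :=
  AlgEquiv.ofAlgHom (MvPowerSeries.rescaleAlgHom fun i => (a i : R))
    (MvPowerSeries.rescaleAlgHom fun i => (↑(a i)⁻¹ : R))
    (by
      rw [← MvPowerSeries.rescaleAlgHom_mul, ← MvPowerSeries.rescaleAlgHom_one]
      exact congrArg _ (_root_.funext fun i => (a i).inv_mul))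
    (by
      rw [← MvPowerSeries.rescaleAlgHom_mul, ← MvPowerSeries.rescaleAlgHom_one]
      exact congrArg _ (_root_.funext fun i => (a i).mul_inv))

theorem rescaleEquiv_X {σ R : Type*} [CommRing R] (a : σ → Rˣ) (i : σ) :
    rescaleEquiv a (MvPowerSeries.X i) = MvPowerSeries.C (a i : R) * MvPowerSeries.X i := by
  change MvPowerSeries.rescaleAlgHom _ _ = _
  rw [MvPowerSeries.rescaleAlgHom_apply, MvPowerSeries.rescale_eq_subst,
    MvPowerSeries.subst_X (MvPowerSeries.HasSubst.smul_X _), Pi.smul_apply',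
    MvPowerSeries.smul_eq_C_mul]

theorem exists_algEquiv_X_zero_eq_C_mul_X_one {R : Type*} [CommRing R] (l : Rˣ) :
    ∃ e : MvPowerSeries (Fin 2) R ≃ₐ[R] MvPowerSeries (Fin 2) R,
      e (MvPowerSeries.X 0) = MvPowerSeries.C (l : R) * MvPowerSeries.X 1 ∧
        e (MvPowerSeries.X 1) = MvPowerSeries.X 0 := by
  have hswap (i : Fin 2) : MvPowerSeries.renameEquiv R (Equiv.swap (0 : Fin 2) 1)
      (MvPowerSeries.X i) = MvPowerSeries.X (Equiv.swap 0 1 i) := MvPowerSeries.rename_X _ _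
  refine ⟨(rescaleEquiv ![l, 1]).trans (MvPowerSeries.renameEquiv R (Equiv.swap 0 1)), ?_, ?_⟩ <;>
    simp [rescaleEquiv_X, hswap]

theorem isDSingularity_mul_sq_sub_pow {p : ℕ} (hp : 2 ≤ p) {a c : ℂ} (ha : a ≠ 0) (hc : c ≠ 0) :
    IsDSingularity (p + 2)
      ((C c * (X 0 * (X 1 ^ 2 - C a * X 0 ^ p)) : MvPolynomial (Fin 2) ℂ) :
        MvPowerSeries (Fin 2) ℂ) := by
  obtain ⟨l, hl⟩ := IsAlgClosed.exists_pow_nat_eq (-a⁻¹) (n := p) (by omega)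
  have hl0 : l ≠ 0 := by
    rintro rfl
    rw [zero_pow (by omega)] at hl
    exact inv_ne_zero ha (neg_eq_zero.1 hl.symm)
  have hal : MvPowerSeries.C (σ := Fin 2) a * MvPowerSeries.C l ^ p = -1 := by
    rw [← map_pow, ← map_mul, hl, mul_neg, mul_inv_cancel₀ ha, map_neg, map_one]
  obtain ⟨e, he₀, he₁⟩ := exists_algEquiv_X_zero_eq_C_mul_X_one (Units.mk0 l hl0)
  have heC (b : ℂ) : e (MvPowerSeries.C b) = MvPowerSeries.C b := e.commutes b
  have hsub (f g : MvPolynomial (Fin 2) ℂ) :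
      ((f - g : MvPolynomial (Fin 2) ℂ) : MvPowerSeries (Fin 2) ℂ) = f - g :=
    map_sub (coeToMvPowerSeries.ringHom (σ := Fin 2) (R := ℂ)) f g
  refine ⟨by omega, e, Units.map (MvPowerSeries.C (σ := Fin 2) (R := ℂ)).toMonoidHom
    (Units.mk0 (c * l) (mul_ne_zero hc hl0)), ?_⟩
  simp only [coe_mul, hsub, coe_X, coe_C, coe_pow, map_mul, map_sub, map_pow, he₀, he₁, heC]
  change _ = MvPowerSeries.C (c * l) * _
  rw [mul_pow, Units.val_mk0, ← mul_assoc (MvPowerSeries.C a), hal, map_mul,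
    Nat.add_sub_assoc one_le_two]
  ring

end DSingularity

/-- The group `G(pq,p,2)`. -/
abbrev planeGroup (p q : ℕ) : Subgroup (GL (Fin 2) ℂ) := imprimitiveGroup (p * q) p 2

/-- The ring of invariants of `G(pq,p,2)`. -/
abbrev PlaneInv (p q : ℕ) : Type := InvRing (planeGroup p q)

/-- The diagonal matrix `diag(u, v)` belongs to `G(pq,p,2)`. -/
structure IsTorusPoint (p q : ℕ) (u v : ℂ) : Prop where
  pow_left : u ^ (p * q) = 1
  pow_right : v ^ (p * q) = 1
  mul_pow : (u * v) ^ q = 1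

namespace IsTorusPoint

variable {p q : ℕ} {u v : ℂ}

theorem one : IsTorusPoint p q 1 1 := ⟨one_pow _, one_pow _, by rw [mul_one, one_pow]⟩

theorem symm (h : IsTorusPoint p q u v) : IsTorusPoint p q v u :=
  ⟨h.pow_right, h.pow_left, mul_comm u v ▸ h.mul_pow⟩

theorem of_mul_eq_one (hu : u ^ (p * q) = 1) (huv : u * v = 1) : IsTorusPoint p q u v :=
  ⟨hu, by simpa [_root_.mul_pow, hu] using congrArg (· ^ (p * q)) huv, by rw [huv, one_pow]⟩

variable [NeZero p] [NeZero q]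

theorem ne_zero_left (h : IsTorusPoint p q u v) : u ≠ 0 := by
  rintro rfl
  exact zero_ne_one ((zero_pow (NeZero.ne (p * q))).symm.trans h.pow_left)

theorem ne_zero_right (h : IsTorusPoint p q u v) : v ≠ 0 := h.symm.ne_zero_left

theorem exists_permMatrix_mem (h : IsTorusPoint p q u v) (s : Equiv.Perm (Fin 2)) :
    ∃ g ∈ planeGroup p q, (g : Matrix (Fin 2) (Fin 2) ℂ) =
      Matrix.of fun i j => if i = s j then ![u, v] j else 0 := by
  have hdet : (Matrix.of fun i j => if i = s j then ![u, v] j else 0).det ≠ 0 := by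
    have hs : s = 1 ∨ s = Equiv.swap 0 1 := by revert s; decide
    rcases hs with rfl | rfl <;> simp [Matrix.det_fin_two, h.ne_zero_left, h.ne_zero_right]
  refine ⟨Matrix.GeneralLinearGroup.mkOfDetNeZero _ hdet,
    ⟨s, ![Units.mk0 u h.ne_zero_left, Units.mk0 v h.ne_zero_right], ?_, ?_, ?_⟩, rfl⟩
  · refine Fin.forall_fin_two.2 ⟨Units.ext h.pow_left, Units.ext h.pow_right⟩
  · rw [Fin.prod_univ_two, Nat.mul_div_cancel_left q (NeZero.pos p)]
    exact Units.ext h.mul_pow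
  · intro i j
    fin_cases j <;> rfl

theorem exists_diag_mem (h : IsTorusPoint p q u v) :
    ∃ g ∈ planeGroup p q, (g : Matrix (Fin 2) (Fin 2) ℂ) = !![u, 0; 0, v] := by
  obtain ⟨g, hg, hgM⟩ := h.exists_permMatrix_mem 1
  refine ⟨g, hg, hgM.trans ?_⟩
  ext i j
  fin_cases i <;> fin_cases j <;> rfl

theorem exists_antidiag_mem (h : IsTorusPoint p q u v) :
    ∃ g ∈ planeGroup p q, (g : Matrix (Fin 2) (Fin 2) ℂ) = !![0, v; u, 0] := by
  obtain ⟨g, hg, hgM⟩ := h.exists_permMatrix_mem (Equiv.swap 0 1)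
  refine ⟨g, hg, hgM.trans ?_⟩
  ext i j
  fin_cases i <;> fin_cases j <;> rfl

end IsTorusPoint

theorem exists_isTorusPoint_of_mem_planeGroup {p q : ℕ} [NeZero p] {g : GL (Fin 2) ℂ}
    (hg : g ∈ planeGroup p q) :
    ∃ u v : ℂ, IsTorusPoint p q u v ∧ ((g : Matrix (Fin 2) (Fin 2) ℂ) = !![u, 0; 0, v] ∨
      (g : Matrix (Fin 2) (Fin 2) ℂ) = !![0, v; u, 0]) := by
  obtain ⟨s, d, hd, hD, hgM⟩ := hg
  rw [Fin.prod_univ_two, Nat.mul_div_cancel_left q (NeZero.pos p)] at hD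
  refine ⟨d 0, d 1, ⟨congrArg Units.val (hd 0), congrArg Units.val (hd 1),
    congrArg Units.val hD⟩, ?_⟩
  have hs : s = 1 ∨ s = Equiv.swap 0 1 := by clear hgM; revert s; decide
  refine hs.imp ?_ ?_ <;>
  · rintro rfl
    ext i j
    rw [hgM]
    fin_cases i <;> fin_cases j <;> rfl

/-- The substitution `x ↦ u x`, `y ↦ v y`, by which `diag(u, v)` acts on polynomials. -/
noncomputable def scaleVars (u v : ℂ) : S →ₐ[ℂ] S := aeval ![C u * X 0, C v * X 1]

/-- The substitution that exchanges the two variables. -/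
noncomputable def swapVars : S →ₐ[ℂ] S := rename (Equiv.swap 0 1)

@[simp] theorem swapVars_X_zero : swapVars (X 0) = X 1 := by simp [swapVars]

@[simp] theorem swapVars_X_one : swapVars (X 1) = X 0 := by simp [swapVars]

@[simp] theorem swapVars_C (a : ℂ) : swapVars (C a) = C a := rename_C _ a

@[simp] theorem swapVars_swapVars (f : S) : swapVars (swapVars f) = f := by
  have : swapVars.comp swapVars = AlgHom.id ℂ S := by
    refine algHom_ext fun i => ?_
    fin_cases i <;> simp
  exact DFunLike.congr_fun this f

@[simp] theorem scaleVars_X_zero (u v : ℂ) : scaleVars u v (X 0) = C u * X 0 := by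
  simp [scaleVars]

@[simp] theorem scaleVars_X_one (u v : ℂ) : scaleVars u v (X 1) = C v * X 1 := by
  simp [scaleVars]

@[simp] theorem scaleVars_C (u v a : ℂ) : scaleVars u v (C a) = C a := (scaleVars u v).commutes a

theorem scaleVars_swapVars (u v : ℂ) (f : S) :
    scaleVars u v (swapVars f) = swapVars (scaleVars v u f) := by
  have : (scaleVars u v).comp swapVars = swapVars.comp (scaleVars v u) := by
    refine algHom_ext fun i => ?_
    fin_cases i <;> simp
  exact DFunLike.congr_fun this f

theorem symRep_of_eq_diag {G : Subgroup (GL (Fin 2) ℂ)} {g : G} {u v : ℂ}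
    (hg : ((g : GL (Fin 2) ℂ) : Matrix (Fin 2) (Fin 2) ℂ) = !![u, 0; 0, v]) (f : S) :
    symRep G g f = scaleVars u v f := by
  have : linSubst (g : GL (Fin 2) ℂ) = scaleVars u v := by
    refine algHom_ext fun i => ?_
    fin_cases i <;> simp [linSubst, hg, Fin.sum_univ_two]
  exact DFunLike.congr_fun this f

theorem symRep_of_eq_antidiag {G : Subgroup (GL (Fin 2) ℂ)} {g : G} {u v : ℂ}
    (hg : ((g : GL (Fin 2) ℂ) : Matrix (Fin 2) (Fin 2) ℂ) = !![0, v; u, 0]) (f : S) :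
    symRep G g f = swapVars (scaleVars u v f) := by
  have : linSubst (g : GL (Fin 2) ℂ) = swapVars.comp (scaleVars u v) := by
    refine algHom_ext fun i => ?_
    fin_cases i <;> simp [linSubst, hg, Fin.sum_univ_two]
  exact DFunLike.congr_fun this f

theorem mem_invariantSubalgebra_planeGroup_iff {p q : ℕ} [NeZero p] [NeZero q] {f : S} :
    f ∈ invariantSubalgebra (planeGroup p q) ↔
      (∀ u v, IsTorusPoint p q u v → scaleVars u v f = f) ∧ swapVars f = f := by
  refine ⟨fun hf => ⟨fun u v h => ?_, ?_⟩, fun ⟨hscale, hswap⟩ g => ?_⟩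
  · obtain ⟨g, hg, hgM⟩ := h.exists_diag_mem
    exact (symRep_of_eq_diag (g := ⟨g, hg⟩) hgM f).symm.trans (hf _)
  · obtain ⟨g, hg, hgM⟩ := (IsTorusPoint.one (p := p) (q := q)).exists_antidiag_mem
    have hscale : scaleVars 1 1 = AlgHom.id ℂ S := by
      refine algHom_ext fun i => ?_
      fin_cases i <;> simp
    have := symRep_of_eq_antidiag (g := ⟨g, hg⟩) hgM f
    rw [hscale] at this
    exact this.symm.trans (hf _)
  · obtain ⟨u, v, h, hg | hg⟩ := exists_isTorusPoint_of_mem_planeGroup g.2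
    · rw [symRep_of_eq_diag hg, hscale u v h]
    · rw [symRep_of_eq_antidiag hg, hscale u v h, hswap]

theorem monomial_fin_two (d : Fin 2 →₀ ℕ) (a : ℂ) :
    (monomial d a : S) = C a * (X 0 ^ d 0 * X 1 ^ d 1) := by
  rw [monomial_eq, Finsupp.prod_fintype _ _ fun _ => pow_zero _, Fin.prod_univ_two]

theorem coeff_scaleVars (u v : ℂ) (f : S) (d : Fin 2 →₀ ℕ) :
    coeff d (scaleVars u v f) = u ^ d 0 * v ^ d 1 * coeff d f := by
  induction f using MvPolynomial.induction_on' with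
  | monomial e a =>
    have hmonomial : scaleVars u v (monomial e a) = C (u ^ e 0 * v ^ e 1) * monomial e a := by
      simp only [monomial_fin_two, map_mul, map_pow, scaleVars_C, scaleVars_X_zero,
        scaleVars_X_one]
      ring
    rw [hmonomial, coeff_C_mul, coeff_monomial]
    split_ifs with h
    · rw [h]
    · rw [mul_zero, mul_zero]
  | add f g hf hg => rw [map_add, coeff_add, coeff_add, hf, hg, mul_add]

section CharacterGrading

variable {p q : ℕ}

/-- The degree of `x ^ k * y ^ l` in the grading of `ℂ[x, y]` by the characters of the diagonal
subgroup of `G(pq,p,2)`. This subgroup is generated by the elements `diag(ζ, ζ⁻¹)` with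
`ζ ^ (p * q) = 1` and `diag(ζ, 1)` with `ζ ^ q = 1`, which give the two components. -/
def charDegree (p q k l : ℕ) : ZMod q × ZMod (p * q) := (k, k - l)

/-- The degrees of the two variables in the grading by characters. -/
def charWeight (p q : ℕ) : Fin 2 → ZMod q × ZMod (p * q) :=
  ![charDegree p q 1 0, charDegree p q 0 1]

theorem weight_charWeight (d : Fin 2 →₀ ℕ) :
    Finsupp.weight (charWeight p q) d = charDegree p q (d 0) (d 1) := by
  rw [Finsupp.weight_apply, Finsupp.sum_fintype _ _ (by simp), Fin.sum_univ_two]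
  simp [charWeight, charDegree, sub_eq_add_neg]

theorem charDegree_add (k l k' l' : ℕ) :
    charDegree p q (k + k') (l + l') = charDegree p q k l + charDegree p q k' l' := by
  ext
  · simp [charDegree]
  · simp only [charDegree, Prod.snd_add]
    push_cast
    ring

theorem charDegree_zero : charDegree p q 0 0 = 0 := by
  simp [charDegree]

theorem charDegree_eq_iff {k l k' l' : ℕ} : charDegree p q k l = charDegree p q k' l' ↔
    (q : ℤ) ∣ k - k' ∧ ((p * q : ℕ) : ℤ) ∣ (k - l) - (k' - l') := by
  rw [← ZMod.intCast_zmod_eq_zero_iff_dvd, ← ZMod.intCast_zmod_eq_zero_iff_dvd, charDegree,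
    charDegree, Prod.mk.injEq, ← sub_eq_zero, ← sub_eq_zero (b := (k' : ZMod (p * q)) - l')]
  push_cast
  rfl

theorem isWeightedHomogeneous_X_pow_mul_X_pow (k l : ℕ) :
    IsWeightedHomogeneous (charWeight p q) (X 0 ^ k * X 1 ^ l : S) (charDegree p q k l) := by
  convert ((isWeightedHomogeneous_X ℂ (charWeight p q) 0).pow k).mul
    ((isWeightedHomogeneous_X ℂ (charWeight p q) 1).pow l) using 1
  simp [charWeight, charDegree, sub_eq_add_neg]

theorem zpow_eq_zpow_of_pow_eq_one {K : Type*} [GroupWithZero K] {x : K} (hx : x ≠ 0) {n : ℕ}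
    (hxn : x ^ n = 1) {k l : ℤ} (h : (n : ℤ) ∣ k - l) : x ^ k = x ^ l := by
  obtain ⟨e, he⟩ := h
  rw [sub_eq_iff_eq_add'.1 he, zpow_add₀ hx, zpow_mul, zpow_natCast, hxn, one_zpow, mul_one]

variable [NeZero p] [NeZero q]

theorem IsTorusPoint.pow_mul_pow_eq {u v : ℂ} (huv : IsTorusPoint p q u v) {k l k' l' : ℕ}
    (h : charDegree p q k l = charDegree p q k' l') : u ^ k * v ^ l = u ^ k' * v ^ l' := by
  obtain ⟨hk, hkl⟩ := charDegree_eq_iff.1 h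
  have hl : (q : ℤ) ∣ l - l' := by
    have hl_eq : (l : ℤ) - l' = (k - k') - ((k - l) - (k' - l')) := by ring
    rw [hl_eq]
    exact dvd_sub hk ((Int.natCast_dvd_natCast.2 (dvd_mul_left q p)).trans hkl)
  have hfactor (k l : ℕ) : u ^ k * v ^ l = u ^ ((k : ℤ) - l) * (u * v) ^ (l : ℤ) := by
    have := huv.ne_zero_left
    rw [zpow_sub₀ this, mul_zpow, zpow_natCast, zpow_natCast, zpow_natCast]
    field_simp
  rw [hfactor, hfactor, zpow_eq_zpow_of_pow_eq_one huv.ne_zero_left huv.pow_left hkl,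
    zpow_eq_zpow_of_pow_eq_one (mul_ne_zero huv.ne_zero_left huv.ne_zero_right) huv.mul_pow hl]

theorem charDegree_eq_of_forall_isTorusPoint {k l k' l' : ℕ}
    (h : ∀ u v : ℂ, IsTorusPoint p q u v → u ^ k * v ^ l = u ^ k' * v ^ l') :
    charDegree p q k l = charDegree p q k' l' := by
  obtain ⟨ζ, hζ⟩ : ∃ ζ : ℂ, IsPrimitiveRoot ζ (p * q) :=
    ⟨_, Complex.isPrimitiveRoot_exp (p * q) (NeZero.ne _)⟩
  have hζ0 : ζ ≠ 0 := hζ.ne_zero (NeZero.ne _)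
  have hdvd {a b : ℤ} (hab : ζ ^ a = ζ ^ b) : ((p * q : ℕ) : ℤ) ∣ a - b := by
    rw [← hζ.zpow_eq_one_iff_dvd, zpow_sub₀ hζ0, hab, div_self (zpow_ne_zero _ hζ0)]
  refine charDegree_eq_iff.2 ⟨?_, hdvd ?_⟩
  · have hpk := h (ζ ^ p) 1 ⟨by rw [pow_right_comm, hζ.pow_eq_one, one_pow], one_pow _,
      by rw [mul_one, ← pow_mul, hζ.pow_eq_one]⟩
    rw [one_pow, one_pow, mul_one, mul_one, ← pow_mul, ← pow_mul, ← zpow_natCast,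
      ← zpow_natCast] at hpk
    have := hdvd hpk
    push_cast at this
    rwa [← mul_sub, mul_dvd_mul_iff_left (Nat.cast_ne_zero.2 (NeZero.ne p))] at this
  · have := h ζ ζ⁻¹ (.of_mul_eq_one hζ.pow_eq_one (mul_inv_cancel₀ hζ0))
    simpa [zpow_sub₀ hζ0, div_eq_mul_inv] using this

theorem isWeightedHomogeneous_charWeight_iff {f : S} {k l : ℕ} :
    IsWeightedHomogeneous (charWeight p q) f (charDegree p q k l) ↔
      ∀ u v : ℂ, IsTorusPoint p q u v → scaleVars u v f = C (u ^ k * v ^ l) * f := by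
  refine ⟨fun hf u v huv => ?_, fun hf d hd => ?_⟩
  · ext d
    rw [coeff_scaleVars, coeff_C_mul]
    by_cases hd : coeff d f = 0
    · rw [hd, mul_zero, mul_zero]
    · rw [huv.pow_mul_pow_eq ((weight_charWeight d).symm.trans (hf hd))]
  · rw [weight_charWeight]
    refine charDegree_eq_of_forall_isTorusPoint fun u v huv => mul_right_cancel₀ hd ?_
    rw [← coeff_scaleVars, hf u v huv, coeff_C_mul]

theorem isWeightedHomogeneous_charWeight_zero_iff {f : S} :
    IsWeightedHomogeneous (charWeight p q) f 0 ↔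
      ∀ u v : ℂ, IsTorusPoint p q u v → scaleVars u v f = f := by
  simp [← charDegree_zero (p := p) (q := q), isWeightedHomogeneous_charWeight_iff]

theorem isWeightedHomogeneous_swapVars {f : S} {k l : ℕ}
    (hf : IsWeightedHomogeneous (charWeight p q) f (charDegree p q k l)) :
    IsWeightedHomogeneous (charWeight p q) (swapVars f) (charDegree p q l k) := by
  rw [isWeightedHomogeneous_charWeight_iff] at hf ⊢
  intro u v huv
  rw [scaleVars_swapVars, hf v u huv.symm, map_mul, swapVars_C, mul_comm (v ^ k)]

end CharacterGrading

section Spanning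

theorem mul_mem_of_mem_range_algebraMap {A B : Type*} [CommRing A] [CommRing B] [Algebra A B]
    (N : Submodule A B) {a b : B} (ha : a ∈ (algebraMap A B).range) (hb : b ∈ N) : a * b ∈ N := by
  obtain ⟨r, rfl⟩ := ha
  rw [← Algebra.smul_def]
  exact N.smul_mem r hb

theorem pow_mul_mem_span_pair {A B : Type*} [CommRing A] [CommRing B] [Algebra A B] {x y g : B}
    {k l : ℕ} (hk : (x * y) ^ k ∈ (algebraMap A B).range)
    (hl : (x * y) ^ l ∈ (algebraMap A B).range)
    (ht : x ^ (k + l) + y ^ (k + l) ∈ (algebraMap A B).range) {f : B}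
    (hf : f ∈ Submodule.span A {g * x ^ k, g * y ^ l}) (n : ℕ) :
    (y ^ (k + l)) ^ n * f ∈ Submodule.span A {g * x ^ k, g * y ^ l} := by
  set N := Submodule.span A {g * x ^ k, g * y ^ l}
  have hx : g * x ^ k ∈ N := Submodule.subset_span (Set.mem_insert _ _)
  have hy : g * y ^ l ∈ N := Submodule.subset_span (Set.mem_insert_of_mem _ rfl)
  have hyx : y ^ (k + l) * (g * x ^ k) = (x * y) ^ k * (g * y ^ l) := by ring
  have hyy : y ^ (k + l) * (g * y ^ l) =
      (x ^ (k + l) + y ^ (k + l)) * (g * y ^ l) - (x * y) ^ l * (g * x ^ k) := by ring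
  have hstep : N ≤ N.comap (LinearMap.mulLeft A (y ^ (k + l))) := by
    rw [Submodule.span_le]
    rintro _ (rfl | rfl)
    · exact (congrArg (· ∈ N) hyx).mpr (mul_mem_of_mem_range_algebraMap N hk hy)
    · exact (congrArg (· ∈ N) hyy).mpr (N.sub_mem (mul_mem_of_mem_range_algebraMap N ht hy)
        (mul_mem_of_mem_range_algebraMap N hl hx))
  have := Submodule.le_comap_pow_of_le_comap N hstep n hf
  rwa [Submodule.mem_comap, LinearMap.pow_mulLeft] at this

theorem pow_mul_mem_span_pair' {A B : Type*} [CommRing A] [CommRing B] [Algebra A B] {x y g : B}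
    {k l : ℕ} (hk : (x * y) ^ k ∈ (algebraMap A B).range)
    (hl : (x * y) ^ l ∈ (algebraMap A B).range)
    (ht : x ^ (k + l) + y ^ (k + l) ∈ (algebraMap A B).range) {f : B}
    (hf : f ∈ Submodule.span A {g * x ^ k, g * y ^ l}) (n : ℕ) :
    (x ^ (k + l)) ^ n * f ∈ Submodule.span A {g * x ^ k, g * y ^ l} := by
  rw [mul_comm x] at hk hl
  rw [add_comm (x ^ _), add_comm k] at ht
  rw [Set.pair_comm] at hf ⊢
  rw [add_comm k]
  exact pow_mul_mem_span_pair hl hk ht hf n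

theorem exists_eq_add_mul_of_dvd_sub {q c k : ℕ} (hc : c < q) (h : (q : ℤ) ∣ k - c) :
    ∃ i, k = c + q * i := by
  have hmod : c = k % q := by rw [← Nat.modEq_iff_dvd.2 h, Nat.mod_eq_of_lt hc]
  exact ⟨k / q, by rw [hmod, Nat.mod_add_div]⟩

variable {p q : ℕ}

theorem exists_exponents_of_charDegree_eq {c e j k l : ℕ} (hc : c < q) (he : e < q) (hj : j ≤ p)
    (h : charDegree p q k l = charDegree p q c (j * q + e)) :
    ∃ i n, (k = c + q * i ∧ l = e + q * (i + j + p * n)) ∨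
      (k = c + q * (i + (p - j) + p * n) ∧ l = e + q * i) := by
  obtain ⟨hk, n, hn⟩ := charDegree_eq_iff.1 h
  have hl : (q : ℤ) ∣ l - e := by
    have hl_eq : (l : ℤ) - e = (k - c) - q * (p * n) + q * j := by
      push_cast at hn
      linarith
    rw [hl_eq]
    exact dvd_add (dvd_sub hk (dvd_mul_right _ _)) (dvd_mul_right _ _)
  obtain ⟨a, rfl⟩ := exists_eq_add_mul_of_dvd_sub hc hk
  obtain ⟨b, rfl⟩ := exists_eq_add_mul_of_dvd_sub he hl
  have hab : (a : ℤ) - b + j = p * n := by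
    refine mul_left_cancel₀ (Int.natCast_ne_zero.2 (Nat.ne_zero_of_lt hc)) ?_
    push_cast at hn
    linarith
  rcases le_or_gt n 0 with hn0 | hn0
  · obtain ⟨n, rfl⟩ : ∃ n' : ℕ, n = -n' := ⟨n.natAbs, by omega⟩
    have hb : b = a + j + p * n := by zify; linarith
    exact ⟨a, n, .inl ⟨rfl, by rw [hb]⟩⟩
  · obtain ⟨n, rfl⟩ : ∃ n' : ℕ, n = n' + 1 := ⟨n.toNat - 1, by omega⟩
    have ha : a = b + (p - j) + p * n := by zify [hj]; linarith
    exact ⟨b, n, .inr ⟨by rw [ha], rfl⟩⟩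

theorem mem_span_of_isWeightedHomogeneous {A : Type*} [CommRing A] [Algebra ℂ A] [Algebra A S]
    [IsScalarTower ℂ A S] (hs : (X 0 * X 1) ^ q ∈ (algebraMap A S).range)
    (ht : X 0 ^ (p * q) + X 1 ^ (p * q) ∈ (algebraMap A S).range) {c e j : ℕ} (hc : c < q)
    (he : e < q) (hj : j ≤ p) {f : S}
    (hf : IsWeightedHomogeneous (charWeight p q) f (charDegree p q c (j * q + e))) :
    f ∈ Submodule.span A {X 0 ^ c * X 1 ^ e * X 0 ^ ((p - j) * q),
      X 0 ^ c * X 1 ^ e * X 1 ^ (j * q)} := by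
  set N : Submodule A S := Submodule.span A {X 0 ^ c * X 1 ^ e * X 0 ^ ((p - j) * q),
    X 0 ^ c * X 1 ^ e * X 1 ^ (j * q)}
  have hpq : (p - j) * q + j * q = p * q := by rw [← add_mul, Nat.sub_add_cancel hj]
  have hs' (n : ℕ) : (X 0 * X 1 : S) ^ (n * q) ∈ (algebraMap A S).range := by
    rw [mul_comm n, pow_mul]
    exact pow_mem hs n
  rw [← hpq] at ht
  have hx (n : ℕ) : (X 0 ^ (p * q)) ^ n * (X 0 ^ c * X 1 ^ e * X 0 ^ ((p - j) * q)) ∈ N := by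
    rw [← hpq]
    exact pow_mul_mem_span_pair' (hs' _) (hs' _) ht (Submodule.subset_span (Set.mem_insert _ _)) n
  have hy (n : ℕ) : (X 1 ^ (p * q)) ^ n * (X 0 ^ c * X 1 ^ e * X 1 ^ (j * q)) ∈ N := by
    rw [← hpq]
    exact pow_mul_mem_span_pair (hs' _) (hs' _) ht
      (Submodule.subset_span (Set.mem_insert_of_mem _ rfl)) n
  rw [f.as_sum]
  refine N.sum_mem fun d hd => ?_
  have hdeg := (weight_charWeight d).symm.trans (hf (mem_support_iff.1 hd))
  rw [monomial_fin_two]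
  refine mul_mem_of_mem_range_algebraMap N
    ⟨algebraMap ℂ A _, (IsScalarTower.algebraMap_apply ℂ A S _).symm⟩ ?_
  obtain ⟨i, n, ⟨hk, hl⟩ | ⟨hk, hl⟩⟩ := exists_exponents_of_charDegree_eq hc he hj hdeg
  · convert mul_mem_of_mem_range_algebraMap N (hs' i) (hy n) using 1
    rw [hk, hl]
    ring
  · convert mul_mem_of_mem_range_algebraMap N (hs' i) (hx n) using 1
    rw [hk, hl]
    ring

end Spanning

section BasicInvariants

theorem algebraicIndependent_of_forall_exists_eval_eq {ι σ K : Type*} [CommRing K] [IsDomain K]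
    [Infinite K] {f : ι → MvPolynomial σ K} (h : ∀ v : ι → K, ∃ x, ∀ i, eval x (f i) = v i) :
    AlgebraicIndependent K f := by
  rw [algebraicIndependent_iff]
  intro P hP
  refine MvPolynomial.funext fun v => ?_
  obtain ⟨x, hx⟩ := h v
  have hcomp : (aeval x).comp (aeval f) = aeval (R := K) v :=
    algHom_ext fun i => by rw [AlgHom.comp_apply, aeval_X, aeval_X, aeval_eq_eval, ← hx i]
  have := DFunLike.congr_fun hcomp P
  rw [AlgHom.comp_apply, hP, map_zero] at this
  rw [map_zero, this, aeval_eq_eval]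

theorem exists_mul_pow_eq_and_pow_add_pow_eq {K : Type*} [Field K] [IsAlgClosed K] (p q : ℕ)
    [NeZero p] [NeZero q] (s t : K) :
    ∃ x y : K, (x * y) ^ q = s ∧ x ^ (p * q) + y ^ (p * q) = t := by
  have hpq : 0 < p * q := NeZero.pos _
  rcases eq_or_ne s 0 with rfl | hs
  · obtain ⟨y, hy⟩ := IsAlgClosed.exists_pow_nat_eq t hpq
    exact ⟨0, y, by rw [zero_mul, zero_pow (NeZero.ne q)], by rw [zero_pow hpq.ne', hy, zero_add]⟩
  · obtain ⟨w, hw⟩ : ∃ w, w ^ 2 - t * w + s ^ p = 0 := by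
      obtain ⟨w, hw⟩ := IsAlgClosed.exists_root
        (Polynomial.C 1 * Polynomial.X ^ 2 + Polynomial.C (-t) * Polynomial.X +
          Polynomial.C (s ^ p)) (by rw [Polynomial.degree_quadratic one_ne_zero]; decide)
      exact ⟨w, by simpa [Polynomial.IsRoot, sub_eq_add_neg] using hw⟩
    have hw0 : w ≠ 0 := by
      rintro rfl
      exact pow_ne_zero p hs (by simpa using hw)
    obtain ⟨x, rfl⟩ := IsAlgClosed.exists_pow_nat_eq w hpq
    obtain ⟨u, rfl⟩ := IsAlgClosed.exists_pow_nat_eq s (NeZero.pos q)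
    have hx0 : x ≠ 0 := ne_zero_pow hpq.ne' hw0
    refine ⟨x, u / x, by rw [mul_div_cancel₀ _ hx0], ?_⟩
    rw [div_pow]
    field_simp
    linear_combination hw

theorem InvRing.incl_injective {n : ℕ} (G : Subgroup (GL (Fin n) ℂ)) :
    Function.Injective (InvRing.incl G) := Subtype.val_injective

theorem pow_sub_pow_ne_zero {R : Type*} [CommRing R] [Nontrivial R] {n : ℕ} (hn : n ≠ 0) :
    (X 0 ^ n - X 1 ^ n : MvPolynomial (Fin 2) R) ≠ 0 := fun h => by
  simpa [hn] using congrArg (eval ![1, 0]) h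

instance {n : ℕ} (G : Subgroup (GL (Fin n) ℂ)) : IsDomain (InvRing G) :=
  inferInstanceAs (IsDomain (invariantSubalgebra G))

variable {p q : ℕ} [NeZero p] [NeZero q]

theorem mem_invariantSubalgebra_iff_isWeightedHomogeneous {f : S} :
    f ∈ invariantSubalgebra (planeGroup p q) ↔
      IsWeightedHomogeneous (charWeight p q) f 0 ∧ swapVars f = f := by
  rw [mem_invariantSubalgebra_planeGroup_iff, isWeightedHomogeneous_charWeight_zero_iff]

theorem isWeightedHomogeneous_incl (r : PlaneInv p q) :
    IsWeightedHomogeneous (charWeight p q) (InvRing.incl _ r) 0 :=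
  (mem_invariantSubalgebra_iff_isWeightedHomogeneous.1 r.2).1

@[simp] theorem swapVars_incl (r : PlaneInv p q) :
    swapVars (InvRing.incl _ r) = InvRing.incl _ r :=
  (mem_invariantSubalgebra_iff_isWeightedHomogeneous.1 r.2).2

theorem mul_pow_mem_invariantSubalgebra :
    (X 0 * X 1) ^ q ∈ invariantSubalgebra (planeGroup p q) := by
  rw [mem_invariantSubalgebra_planeGroup_iff]
  refine ⟨fun u v huv => ?_, by simp [mul_comm]⟩
  have hC : (C u * C v : S) ^ q = 1 := by rw [← C_mul, ← C_pow, huv.mul_pow, C_1]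
  rw [map_pow, map_mul, scaleVars_X_zero, scaleVars_X_one, mul_mul_mul_comm, _root_.mul_pow, hC,
    one_mul]

theorem pow_add_pow_mem_invariantSubalgebra :
    X 0 ^ (p * q) + X 1 ^ (p * q) ∈ invariantSubalgebra (planeGroup p q) := by
  rw [mem_invariantSubalgebra_planeGroup_iff]
  refine ⟨fun u v huv => ?_, by simp [add_comm]⟩
  rw [map_add, map_pow, map_pow, scaleVars_X_zero, scaleVars_X_one, _root_.mul_pow,
    _root_.mul_pow, ← C_pow, ← C_pow, huv.pow_left, huv.pow_right, C_1, one_mul, one_mul]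

variable (p q) in
/-- The basic invariant `σ₁ = (x y) ^ q`. -/
noncomputable def sigmaOne : PlaneInv p q := ⟨_, mul_pow_mem_invariantSubalgebra⟩

variable (p q) in
/-- The basic invariant `σ₂ = x ^ m + y ^ m`, where `m = p q`. -/
noncomputable def sigmaTwo : PlaneInv p q := ⟨_, pow_add_pow_mem_invariantSubalgebra⟩

variable (p q) in
/-- The discriminant `σ₁ (σ₂ ^ 2 - 4 σ₁ ^ p)`, normalised. -/
noncomputable def sigmaDisc : PlaneInv p q :=
  sigmaOne p q * (sigmaTwo p q ^ 2 - 4 * sigmaOne p q ^ p)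

@[simp] theorem incl_sigmaOne : InvRing.incl _ (sigmaOne p q) = (X 0 * X 1) ^ q := rfl

@[simp] theorem incl_sigmaTwo :
    InvRing.incl _ (sigmaTwo p q) = X 0 ^ (p * q) + X 1 ^ (p * q) := rfl

theorem incl_sigmaDisc : InvRing.incl _ (sigmaDisc p q) =
    (X 0 * X 1) ^ q * (X 0 ^ (p * q) - X 1 ^ (p * q)) ^ 2 := by
  rw [sigmaDisc]
  simp only [map_mul, map_sub, map_pow, map_ofNat, incl_sigmaOne, incl_sigmaTwo]
  ring

theorem sigmaDisc_ne_zero : sigmaDisc p q ≠ 0 := fun h => by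
  refine mul_ne_zero (pow_ne_zero q (mul_ne_zero (X_ne_zero 0) (X_ne_zero 1)))
    (pow_ne_zero 2 (pow_sub_pow_ne_zero (R := ℂ) (NeZero.ne (p * q)))) ?_
  rw [← incl_sigmaDisc, h, map_zero]

theorem adjoin_sigma_eq_top : Algebra.adjoin ℂ {sigmaOne p q, sigmaTwo p q} = ⊤ := by
  refine Algebra.eq_top_iff.2 fun r => ?_
  set A := Algebra.adjoin ℂ {sigmaOne p q, sigmaTwo p q}
  have hspan := mem_span_of_isWeightedHomogeneous (A := A) (p := p) (q := q) (c := 0) (e := 0)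
    (j := 0) ⟨⟨_, Algebra.subset_adjoin (Set.mem_insert _ _)⟩, incl_sigmaOne (p := p) (q := q)⟩
    ⟨⟨_, Algebra.subset_adjoin (Set.mem_insert_of_mem _ rfl)⟩, incl_sigmaTwo⟩ (NeZero.pos q)
    (NeZero.pos q) (Nat.zero_le p) (f := InvRing.incl _ r)
    (by simpa [charDegree_zero] using isWeightedHomogeneous_incl r)
  obtain ⟨a, b, hab⟩ := Submodule.mem_span_pair.1 hspan
  have hab' : algebraMap A S a * X 0 ^ (p * q) + algebraMap A S b = InvRing.incl _ r := by
    simpa [Algebra.smul_def] using hab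
  replace hab : InvRing.incl _ (a : PlaneInv p q) * X 0 ^ (p * q) + InvRing.incl _ b.1 =
      InvRing.incl _ r := hab'
  have hswap : InvRing.incl _ (a : PlaneInv p q) * X 1 ^ (p * q) + InvRing.incl _ b.1 =
      InvRing.incl _ r := by
    simpa using congrArg swapVars hab
  have ha : InvRing.incl _ (a : PlaneInv p q) = 0 :=
    (mul_eq_zero.1 (by linear_combination hab - hswap)).resolve_right
      (pow_sub_pow_ne_zero (NeZero.ne (p * q)))
  rw [ha, zero_mul, zero_add] at hab
  exact InvRing.incl_injective _ hab ▸ b.2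

theorem algebraicIndependent_sigma : AlgebraicIndependent ℂ ![sigmaOne p q, sigmaTwo p q] := by
  refine AlgebraicIndependent.of_comp (InvRing.incl _)
    (algebraicIndependent_of_forall_exists_eval_eq fun v => ?_)
  obtain ⟨x, y, hx, hy⟩ := exists_mul_pow_eq_and_pow_add_pow_eq p q (v 0) (v 1)
  refine ⟨![x, y], Fin.forall_fin_two.2 ⟨?_, ?_⟩⟩
  · simpa using hx
  · simpa using hy

theorem nonempty_mvPolynomial_algEquiv_planeInv : Nonempty (S ≃ₐ[ℂ] PlaneInv p q) := by
  have htop := adjoin_sigma_eq_top (p := p) (q := q)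
  rw [← Matrix.range_cons_cons_empty _ _ ![]] at htop
  exact ⟨(algebraicIndependent_sigma.aevalEquiv.trans (Subalgebra.equivOfEq _ _ htop)).trans
    Subalgebra.topEquiv⟩

instance : UniqueFactorizationMonoid (PlaneInv p q) := by
  obtain ⟨e⟩ := nonempty_mvPolynomial_algEquiv_planeInv (p := p) (q := q)
  exact e.toMulEquiv.uniqueFactorizationMonoid inferInstance

theorem ringKrullDim_planeInv : ringKrullDim (PlaneInv p q) = 2 := by
  obtain ⟨e⟩ := nonempty_mvPolynomial_algEquiv_planeInv (p := p) (q := q)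
  rw [← ringKrullDim_eq_of_ringEquiv e.toRingEquiv, MvPolynomial.ringKrullDim_of_isNoetherianRing,
    ringKrullDim_eq_zero_of_field]
  simp

end BasicInvariants

section Arrangement

/-- The line `c x + d y = 0` in the plane of row vectors. -/
noncomputable def planeLine (c d : ℂ) : Submodule ℂ (Fin 2 → ℂ) :=
  LinearMap.ker (c • LinearMap.proj 0 + d • LinearMap.proj 1 : (Fin 2 → ℂ) →ₗ[ℂ] ℂ)

theorem mem_planeLine {c d : ℂ} {v : Fin 2 → ℂ} : v ∈ planeLine c d ↔ c * v 0 + d * v 1 = 0 := by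
  simp [planeLine]

theorem vec_mem_planeLine (c d : ℂ) : ![d, -c] ∈ planeLine c d := by
  simp [mem_planeLine, mul_comm]

theorem mul_eq_mul_of_planeLine_eq {c d c' d' : ℂ} (h : planeLine c d = planeLine c' d') :
    c' * d = d' * c := by
  have := vec_mem_planeLine c d
  rw [h, mem_planeLine] at this
  simpa [← sub_eq_add_neg, sub_eq_zero] using this

theorem finrank_planeLine {c d : ℂ} (h : c ≠ 0 ∨ d ≠ 0) :
    Module.finrank ℂ (planeLine c d) + 1 = 2 := by
  have hne : (c • LinearMap.proj 0 + d • LinearMap.proj 1 : (Fin 2 → ℂ) →ₗ[ℂ] ℂ) ≠ 0 := fun h0 => by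
    have hc := LinearMap.congr_fun h0 ![1, 0]
    have hd := LinearMap.congr_fun h0 ![0, 1]
    simp only [LinearMap.add_apply, LinearMap.smul_apply, LinearMap.proj_apply] at hc hd
    exact h.elim (fun hc' => hc' (by simpa using hc)) fun hd' => hd' (by simpa using hd)
  rw [planeLine, Module.Dual.finrank_ker_add_one_of_ne_zero hne, Module.finrank_fin_fun]

theorem eq_planeLine_of_le {c d : ℂ} (h : c ≠ 0 ∨ d ≠ 0) {L : Submodule ℂ (Fin 2 → ℂ)}
    (hL : Module.finrank ℂ L + 1 = 2) (hle : L ≤ planeLine c d) : L = planeLine c d :=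
  Submodule.eq_of_le_of_finrank_eq hle (by have := finrank_planeLine h; omega)

theorem planeLine_eq_span {c d : ℂ} (h : c ≠ 0 ∨ d ≠ 0) :
    planeLine c d = Submodule.span ℂ {![d, -c]} := by
  have hne : ![d, -c] ≠ 0 := fun h0 => by
    have hc := congrFun h0 1
    have hd := congrFun h0 0
    exact h.elim (fun hc' => hc' (by simpa using hc)) fun hd' => hd' (by simpa using hd)
  refine (eq_planeLine_of_le h (by rw [finrank_span_singleton hne]) ?_).symm
  rw [Submodule.span_singleton_le_iff_mem]
  exact vec_mem_planeLine c d

theorem exists_eq_C_mul_of_isDefiningForm {c d : ℂ} (h : c ≠ 0 ∨ d ≠ 0) {f : S}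
    (hf : IsDefiningForm (planeLine c d) f) :
    ∃ k : ℂ, k ≠ 0 ∧ f = C k * (C c * X 0 + C d * X 1) := by
  obtain ⟨⟨a, rfl⟩, hv⟩ := hf
  have hL : planeLine c d = planeLine (a 0) (a 1) := by
    ext v
    simp [hv, mem_planeLine, Fin.sum_univ_two]
  have hprop : a 0 * d = a 1 * c := mul_eq_mul_of_planeLine_eq hL
  obtain ⟨k, hk0, hk1⟩ : ∃ k, a 0 = k * c ∧ a 1 = k * d := by
    rcases eq_or_ne c 0 with rfl | hc
    · have hd : d ≠ 0 := h.resolve_left (not_not.2 rfl)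
      exact ⟨a 1 / d, by simpa [hd] using hprop, by field_simp⟩
    · exact ⟨a 0 / c, by field_simp, by field_simp; exact hprop.symm⟩
  refine ⟨k, ?_, ?_⟩
  · rintro rfl
    have htop : planeLine c d = ⊤ := by
      ext v
      simp [hL, hk0, hk1, mem_planeLine]
    have := finrank_planeLine h
    rw [htop, finrank_top, Module.finrank_fin_fun] at this
    omega
  · rw [Fin.sum_univ_two, hk0, hk1, map_mul, map_mul]
    ring

theorem associated_of_isDefiningForm {c d : ℂ} (h : c ≠ 0 ∨ d ≠ 0) {f : S}
    (hf : IsDefiningForm (planeLine c d) f) : Associated f (C c * X 0 + C d * X 1) := by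
  obtain ⟨k, hk, rfl⟩ := exists_eq_C_mul_of_isDefiningForm h hf
  exact associated_unit_mul_left _ _ ((isUnit_iff_ne_zero.2 hk).map C)

theorem vecMul_diag {R : Type*} [CommSemiring R] (u w : R) (v : Fin 2 → R) :
    Matrix.vecMul v !![u, 0; 0, w] = v ↔ v 0 * u = v 0 ∧ v 1 * w = v 1 := by
  rw [_root_.funext_iff, Fin.forall_fin_two]
  simp [Matrix.vecMul, dotProduct, Fin.sum_univ_two]

theorem vecMul_antidiag {R : Type*} [CommSemiring R] (u w : R) (v : Fin 2 → R) :
    Matrix.vecMul v !![0, w; u, 0] = v ↔ v 1 * u = v 0 ∧ v 0 * w = v 1 := by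
  rw [_root_.funext_iff, Fin.forall_fin_two]
  simp [Matrix.vecMul, dotProduct, Fin.sum_univ_two]

theorem fixerOrder_span_singleton {n : ℕ} (G : Subgroup (GL (Fin n) ℂ)) (w : Fin n → ℂ) :
    fixerOrder G (Submodule.span ℂ {w}) =
      {M | (∃ g ∈ G, (g : Matrix (Fin n) (Fin n) ℂ) = M) ∧ Matrix.vecMul w M = w}.ncard := by
  change Set.ncard {g : GL (Fin n) ℂ |
    g ∈ G ∧ ∀ v ∈ Submodule.span ℂ {w}, Matrix.vecMul v g = v} = _
  rw [← Set.ncard_image_of_injective _ Units.val_injective]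
  congr 1
  ext M
  constructor
  · rintro ⟨g, ⟨hg, hfix⟩, rfl⟩
    exact ⟨⟨g, hg, rfl⟩, hfix w (Submodule.mem_span_singleton_self w)⟩
  · rintro ⟨⟨g, hg, rfl⟩, hfix⟩
    refine ⟨g, ⟨hg, fun v hv => ?_⟩, rfl⟩
    obtain ⟨a, rfl⟩ := Submodule.mem_span_singleton.1 hv
    rw [Matrix.smul_vecMul, hfix]

theorem ncard_pow_eq_one {n : ℕ} [NeZero n] : {a : ℂ | a ^ n = 1}.ncard = n := by
  have h : {a : ℂ | a ^ n = 1} = (Polynomial.nthRootsFinset n (1 : ℂ) : Set ℂ) := by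
    ext a
    simp [Polynomial.mem_nthRootsFinset (NeZero.pos n)]
  rw [h, Set.ncard_coe_finset, (Complex.isPrimitiveRoot_exp n (NeZero.ne n)).card_nthRootsFinset]

theorem prod_nthRootsFinset_X_sub_C_mul_X {n : ℕ} (hn : 0 < n) :
    ∏ a ∈ Polynomial.nthRootsFinset n (1 : ℂ), (X 0 - C a * X 1 : S) = X 0 ^ n - X 1 ^ n := by
  have hζ := Complex.isPrimitiveRoot_exp n hn.ne'
  have hζ' := hζ.map_of_injective (f := (C : ℂ →+* S)) (C_injective _ _)
  have himage : (Polynomial.nthRootsFinset n (1 : ℂ)).image (C : ℂ → S) =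
      Polynomial.nthRootsFinset n 1 := by
    refine Finset.eq_of_subset_of_card_le (Finset.image_subset_iff.2 fun a ha => ?_) ?_
    · rw [Polynomial.mem_nthRootsFinset hn] at ha ⊢
      rw [← C_pow, ha, C_1]
    · rw [Finset.card_image_of_injective _ (C_injective _ _), hζ.card_nthRootsFinset,
        hζ'.card_nthRootsFinset]
  rw [hζ'.pow_sub_pow_eq_prod_sub_mul _ _ hn, ← himage, Finset.prod_image (C_injective _ _).injOn]

theorem isTorusPoint_one_right_iff {p q : ℕ} {u : ℂ} : IsTorusPoint p q u 1 ↔ u ^ q = 1 :=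
  ⟨fun h => by simpa using h.mul_pow, fun h =>
    ⟨by rw [mul_comm, pow_mul, h, one_pow], one_pow _, by rwa [mul_one]⟩⟩

variable {p q : ℕ} [NeZero p] [NeZero q]

theorem exists_mem_planeGroup_coe_eq_iff {M : Matrix (Fin 2) (Fin 2) ℂ} :
    (∃ g ∈ planeGroup p q, (g : Matrix (Fin 2) (Fin 2) ℂ) = M) ↔
      ∃ u v, IsTorusPoint p q u v ∧ (M = !![u, 0; 0, v] ∨ M = !![0, v; u, 0]) := by
  constructor
  · rintro ⟨g, hg, rfl⟩
    exact exists_isTorusPoint_of_mem_planeGroup hg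
  · rintro ⟨u, v, h, rfl | rfl⟩
    exacts [h.exists_diag_mem, h.exists_antidiag_mem]

theorem fixerOrder_planeLine_one_zero : fixerOrder (planeGroup p q) (planeLine 1 0) = q := by
  rw [planeLine_eq_span (by simp), fixerOrder_span_singleton]
  have hset : {M | (∃ g ∈ planeGroup p q, (g : Matrix (Fin 2) (Fin 2) ℂ) = M) ∧
      Matrix.vecMul ![0, -1] M = ![0, -1]} = (fun u => !![u, 0; 0, 1]) '' {u : ℂ | u ^ q = 1} := by
    ext M
    rw [Set.mem_ofPred_eq, exists_mem_planeGroup_coe_eq_iff]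
    constructor
    · rintro ⟨⟨u, v, h, rfl | rfl⟩, hM⟩
      · obtain rfl : v = 1 := by simpa using ((vecMul_diag _ _ _).1 hM).2
        exact ⟨u, isTorusPoint_one_right_iff.1 h, rfl⟩
      · exact absurd ((vecMul_antidiag _ _ _).1 hM).2 (by simp)
    · rintro ⟨u, hu, rfl⟩
      exact ⟨⟨u, 1, isTorusPoint_one_right_iff.2 hu, .inl rfl⟩, (vecMul_diag _ _ _).2 (by simp)⟩
  rw [hset, Set.ncard_image_of_injective _ fun u v h => by simpa using congrFun₂ h 0 0,
    ncard_pow_eq_one]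

theorem fixerOrder_planeLine_zero_one : fixerOrder (planeGroup p q) (planeLine 0 1) = q := by
  rw [planeLine_eq_span (by simp), fixerOrder_span_singleton]
  have hset : {M | (∃ g ∈ planeGroup p q, (g : Matrix (Fin 2) (Fin 2) ℂ) = M) ∧
      Matrix.vecMul ![1, -0] M = ![1, -0]} = (fun v => !![1, 0; 0, v]) '' {v : ℂ | v ^ q = 1} := by
    ext M
    rw [Set.mem_ofPred_eq, exists_mem_planeGroup_coe_eq_iff]
    constructor
    · rintro ⟨⟨u, v, h, rfl | rfl⟩, hM⟩
      · obtain rfl : u = 1 := by simpa using ((vecMul_diag _ _ _).1 hM).1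
        exact ⟨v, isTorusPoint_one_right_iff.1 h.symm, rfl⟩
      · exact absurd ((vecMul_antidiag _ _ _).1 hM).1 (by simp)
    · rintro ⟨v, hv, rfl⟩
      exact ⟨⟨1, v, (isTorusPoint_one_right_iff.2 hv).symm, .inl rfl⟩,
        (vecMul_diag _ _ _).2 (by simp)⟩
  rw [hset, Set.ncard_image_of_injective _ fun u v h => by simpa using congrFun₂ h 1 1,
    ncard_pow_eq_one]

theorem fixerOrder_planeLine_one_neg {a : ℂ} (ha : a ^ (p * q) = 1) :
    fixerOrder (planeGroup p q) (planeLine 1 (-a)) = 2 := by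
  have ha0 : a ≠ 0 := by
    rintro rfl
    exact zero_ne_one ((zero_pow (NeZero.ne (p * q))).symm.trans ha)
  rw [planeLine_eq_span (by simp), fixerOrder_span_singleton]
  have hset : {M | (∃ g ∈ planeGroup p q, (g : Matrix (Fin 2) (Fin 2) ℂ) = M) ∧
      Matrix.vecMul ![-a, -1] M = ![-a, -1]} = {!![1, 0; 0, 1], !![0, a⁻¹; a, 0]} := by
    ext M
    rw [Set.mem_ofPred_eq, exists_mem_planeGroup_coe_eq_iff]
    constructor
    · rintro ⟨⟨u, v, h, rfl | rfl⟩, hM⟩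
      · rw [vecMul_diag] at hM
        obtain rfl : u = 1 := by simpa [ha0] using hM.1
        obtain rfl : v = 1 := by simpa using hM.2
        exact .inl rfl
      · rw [vecMul_antidiag] at hM
        obtain rfl : u = a := by simpa using hM.1
        obtain rfl : v = u⁻¹ := eq_inv_of_mul_eq_one_right (by simpa using hM.2)
        exact .inr rfl
    · rintro (rfl | rfl)
      · exact ⟨⟨1, 1, .one, .inl rfl⟩, (vecMul_diag _ _ _).2 (by simp)⟩
      · exact ⟨⟨a, a⁻¹, .of_mul_eq_one ha (mul_inv_cancel₀ ha0), .inr rfl⟩,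
          (vecMul_antidiag _ _ _).2 (by simp [ha0])⟩
  rw [hset, Set.ncard_pair fun h => by simpa using congrFun₂ h 0 0]

theorem reflectingHyperplanes_subset :
    reflectingHyperplanes (planeGroup p q) ⊆
      insert (planeLine 1 0) (insert (planeLine 0 1)
        ((fun a : ℂ => planeLine 1 (-a)) '' Polynomial.nthRootsFinset (p * q) (1 : ℂ))) := by
  rintro L ⟨hfr, g, hg, hL⟩
  obtain ⟨u, v, h, hM | hM⟩ := exists_isTorusPoint_of_mem_planeGroup hg
  · simp only [hM, vecMul_diag] at hL
    rcases eq_or_ne u 1 with rfl | hu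
    · rcases eq_or_ne v 1 with rfl | hv
      · obtain rfl : L = ⊤ := by
          ext x
          simp [hL]
        simp at hfr
      · refine .inr (.inl (eq_planeLine_of_le (by simp) hfr fun x hx => mem_planeLine.2 ?_))
        simpa using (mul_right_eq_self₀.1 ((hL x).1 hx).2).resolve_left hv
    · refine .inl (eq_planeLine_of_le (by simp) hfr fun x hx => mem_planeLine.2 ?_)
      simpa using (mul_right_eq_self₀.1 ((hL x).1 hx).1).resolve_left hu
  · simp only [hM, vecMul_antidiag] at hL
    refine .inr (.inr ⟨u, (Polynomial.mem_nthRootsFinset (NeZero.pos _) 1).2 h.pow_left,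
      (eq_planeLine_of_le (by simp) hfr fun x hx => mem_planeLine.2 ?_).symm⟩)
    linear_combination -((hL x).1 hx).1

theorem planeLine_one_neg_mem_reflectingHyperplanes {a : ℂ} (ha : a ^ (p * q) = 1) :
    planeLine 1 (-a) ∈ reflectingHyperplanes (planeGroup p q) := by
  have ha0 : a ≠ 0 := by
    rintro rfl
    exact zero_ne_one ((zero_pow (NeZero.ne (p * q))).symm.trans ha)
  obtain ⟨g, hg, hM⟩ :=
    (IsTorusPoint.of_mul_eq_one (p := p) (q := q) ha (mul_inv_cancel₀ ha0)).exists_antidiag_mem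
  refine ⟨finrank_planeLine (by simp), g, hg, fun v => ?_⟩
  rw [hM, vecMul_antidiag, mem_planeLine]
  constructor
  · intro hv
    have hv0 : v 0 = v 1 * a := by linear_combination hv
    exact ⟨hv0.symm, by rw [hv0, mul_assoc, mul_inv_cancel₀ ha0, mul_one]⟩
  · rintro ⟨hv, -⟩
    linear_combination -hv

theorem planeLine_one_zero_mem_reflectingHyperplanes (hq : 2 ≤ q) :
    planeLine 1 0 ∈ reflectingHyperplanes (planeGroup p q) := by
  have hζ := Complex.isPrimitiveRoot_exp q (NeZero.ne q)
  obtain ⟨g, hg, hM⟩ :=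
    ((isTorusPoint_one_right_iff (p := p)).2 hζ.pow_eq_one).exists_diag_mem
  refine ⟨finrank_planeLine (by simp), g, hg, fun v => ?_⟩
  rw [hM, vecMul_diag, mem_planeLine, mul_right_eq_self₀, or_iff_right (hζ.ne_one hq)]
  simp

theorem planeLine_zero_one_mem_reflectingHyperplanes (hq : 2 ≤ q) :
    planeLine 0 1 ∈ reflectingHyperplanes (planeGroup p q) := by
  have hζ := Complex.isPrimitiveRoot_exp q (NeZero.ne q)
  obtain ⟨g, hg, hM⟩ :=
    ((isTorusPoint_one_right_iff (p := p)).2 hζ.pow_eq_one).symm.exists_diag_mem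
  refine ⟨finrank_planeLine (by simp), g, hg, fun v => ?_⟩
  rw [hM, vecMul_diag, mem_planeLine, mul_right_eq_self₀, mul_right_eq_self₀,
    or_iff_right (hζ.ne_one hq)]
  simp

theorem reflectingHyperplanes_planeGroup (hq : 2 ≤ q) :
    reflectingHyperplanes (planeGroup p q) =
      insert (planeLine 1 0) (insert (planeLine 0 1)
        ((fun a : ℂ => planeLine 1 (-a)) '' Polynomial.nthRootsFinset (p * q) (1 : ℂ))) := by
  refine reflectingHyperplanes_subset.antisymm ?_
  rintro L (rfl | rfl | ⟨a, ha, rfl⟩)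
  · exact planeLine_one_zero_mem_reflectingHyperplanes hq
  · exact planeLine_zero_one_mem_reflectingHyperplanes hq
  · exact planeLine_one_neg_mem_reflectingHyperplanes
      ((Polynomial.mem_nthRootsFinset (NeZero.pos _) 1).1 ha)

theorem finprod_mem_reflectingHyperplanes_planeGroup (hq : 2 ≤ q) {M : Type*} [CommMonoid M]
    (F : Submodule ℂ (Fin 2 → ℂ) → M) :
    ∏ᶠ L ∈ reflectingHyperplanes (planeGroup p q), F L =
      F (planeLine 1 0) * (F (planeLine 0 1) *
        ∏ a ∈ Polynomial.nthRootsFinset (p * q) (1 : ℂ), F (planeLine 1 (-a))) := by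
  have hfin := ((Polynomial.nthRootsFinset (p * q) (1 : ℂ)).finite_toSet.image
    fun a : ℂ => planeLine 1 (-a))
  have hinj : Function.Injective fun a : ℂ => planeLine 1 (-a) := fun a b h => by
    simpa using mul_eq_mul_of_planeLine_eq h
  rw [reflectingHyperplanes_planeGroup hq, finprod_mem_insert _ _ (hfin.insert _),
    finprod_mem_insert _ _ hfin, finprod_mem_image hinj.injOn, finprod_mem_coe_finset]
  · rintro ⟨a, -, h⟩
    simpa using mul_eq_mul_of_planeLine_eq h
  · rintro (h | ⟨a, ha, h⟩)
    · simpa using mul_eq_mul_of_planeLine_eq h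
    · obtain rfl : a = 0 := by simpa using mul_eq_mul_of_planeLine_eq h
      simp [Polynomial.mem_nthRootsFinset (NeZero.pos (p * q)), NeZero.ne p, NeZero.ne q] at ha

variable {α : Submodule ℂ (Fin 2 → ℂ) → S}

theorem associated_finprod_mem_reflectingHyperplanes (hq : 2 ≤ q)
    (hα : ∀ L ∈ reflectingHyperplanes (planeGroup p q), IsDefiningForm L (α L))
    {e : Submodule ℂ (Fin 2 → ℂ) → ℕ} {a b : ℕ} (he₀ : e (planeLine 1 0) = a)
    (he₁ : e (planeLine 0 1) = a) (he : ∀ c : ℂ, c ^ (p * q) = 1 → e (planeLine 1 (-c)) = b) :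
    Associated (∏ᶠ L ∈ reflectingHyperplanes (planeGroup p q), α L ^ e L)
      ((X 0 * X 1) ^ a * (X 0 ^ (p * q) - X 1 ^ (p * q)) ^ b) := by
  have h₀ := associated_of_isDefiningForm (by simp)
    (hα _ (planeLine_one_zero_mem_reflectingHyperplanes hq))
  have h₁ := associated_of_isDefiningForm (by simp)
    (hα _ (planeLine_zero_one_mem_reflectingHyperplanes hq))
  have h : ∀ c ∈ Polynomial.nthRootsFinset (p * q) (1 : ℂ),
      Associated (α (planeLine 1 (-c)) ^ e (planeLine 1 (-c))) ((X 0 - C c * X 1) ^ b) := by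
    intro c hc
    rw [Polynomial.mem_nthRootsFinset (NeZero.pos _)] at hc
    have := associated_of_isDefiningForm (by simp)
      (hα _ (planeLine_one_neg_mem_reflectingHyperplanes hc))
    rw [C_1, one_mul, C_neg, neg_mul, ← sub_eq_add_neg] at this
    exact he c hc ▸ this.pow_pow
  simp only [C_1, C_0, one_mul, zero_mul, add_zero, zero_add] at h₀ h₁
  rw [finprod_mem_reflectingHyperplanes_planeGroup hq, he₀, he₁, _root_.mul_pow, mul_assoc,
    ← prod_nthRootsFinset_X_sub_C_mul_X (NeZero.pos _), ← Finset.prod_pow]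
  exact h₀.pow_pow.mul_mul (h₁.pow_pow.mul_mul (Associated.prod _ _ _ h))

theorem exists_eq_C_mul_of_associated {σ K : Type*} [Field K] {f g : MvPolynomial σ K}
    (h : Associated f g) : ∃ k : K, k ≠ 0 ∧ f = C k * g := by
  obtain ⟨u, rfl⟩ := h.symm
  obtain ⟨k, hk, hu⟩ := isUnit_iff_eq_C_of_isReduced.1 u.isUnit
  exact ⟨k, hk.ne_zero, by rw [hu, mul_comm]⟩

theorem exists_arrangementPoly_eq (hq : 2 ≤ q)
    (hα : ∀ L ∈ reflectingHyperplanes (planeGroup p q), IsDefiningForm L (α L)) :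
    ∃ k : ℂ, k ≠ 0 ∧ arrangementPoly (planeGroup p q) α =
      C k * (X 0 * X 1 * (X 0 ^ (p * q) - X 1 ^ (p * q))) := by
  refine exists_eq_C_mul_of_associated ?_
  simpa only [arrangementPoly, pow_one] using
    associated_finprod_mem_reflectingHyperplanes (e := fun _ => 1) hq hα rfl rfl fun _ _ => rfl

theorem exists_discriminantPoly_eq (hq : 2 ≤ q)
    (hα : ∀ L ∈ reflectingHyperplanes (planeGroup p q), IsDefiningForm L (α L)) :
    ∃ k : ℂ, k ≠ 0 ∧
      discriminantPoly (planeGroup p q) α = C k * InvRing.incl _ (sigmaDisc p q) := by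
  rw [incl_sigmaDisc]
  exact exists_eq_C_mul_of_associated (associated_finprod_mem_reflectingHyperplanes hq hα
    fixerOrder_planeLine_one_zero fixerOrder_planeLine_zero_one
    fun _ => fixerOrder_planeLine_one_neg)

end Arrangement

section WeightSpaces

theorem weightedHomogeneousComponent_mul_of_left {σ R M : Type*} [CommSemiring R]
    [AddCancelCommMonoid M] {w : σ → M} {z : MvPolynomial σ R} {k : M}
    (hz : IsWeightedHomogeneous w z k) (n : M) (f : MvPolynomial σ R) :
    weightedHomogeneousComponent w (k + n) (z * f) = z * weightedHomogeneousComponent w n f := by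
  classical
  let := weightedGradedAlgebra R w
  have hmul := DirectSum.coe_decompose_mul_add_of_left_mem (weightedHomogeneousSubmodule R w)
    (i := k) (j := n) (b := f) ((mem_weightedHomogeneousSubmodule R w k z).2 hz)
  simp_rw [← weightedDecomposition.decompose'_apply]
  exact hmul

variable (p q : ℕ) [NeZero p] [NeZero q]

/-- The polynomials on which the diagonal matrices `diag(u, v)` of `G(pq, p, 2)` act through the
character `u ^ k * v ^ l`. -/
noncomputable def weightSpace (k l : ℕ) : Submodule (PlaneInv p q) S where
  carrier := {f | IsWeightedHomogeneous (charWeight p q) f (charDegree p q k l)}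
  add_mem' := IsWeightedHomogeneous.add
  zero_mem' := isWeightedHomogeneous_zero ℂ _ _
  smul_mem' r f hf := by
    have h := (isWeightedHomogeneous_incl r).mul hf
    rwa [zero_add] at h

/-- The projection of `S` onto `weightSpace p q k l` along the other weight spaces. -/
noncomputable def weightProj (k l : ℕ) : S →ₗ[PlaneInv p q] S where
  toFun := weightedHomogeneousComponent (charWeight p q) (charDegree p q k l)
  map_add' := map_add _
  map_smul' r f := by
    have h := weightedHomogeneousComponent_mul_of_left (isWeightedHomogeneous_incl r)
      (charDegree p q k l) f
    rwa [zero_add] at h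

/-- `swapVars` as a map that is linear over the invariant ring. -/
noncomputable def swapLinear : S →ₗ[PlaneInv p q] S where
  toFun := swapVars
  map_add' := map_add _
  map_smul' r f := (map_mul swapVars (InvRing.incl _ r) f).trans (by rw [swapVars_incl]; rfl)

variable {p q} {k l k' l' : ℕ} {f z : S}

theorem mem_weightSpace_iff : f ∈ weightSpace p q k l ↔
    ∀ u v, IsTorusPoint p q u v → scaleVars u v f = C (u ^ k * v ^ l) * f :=
  isWeightedHomogeneous_charWeight_iff

theorem X_pow_mul_X_pow_mem_weightSpace : X 0 ^ k * X 1 ^ l ∈ weightSpace p q k l :=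
  isWeightedHomogeneous_X_pow_mul_X_pow k l

theorem weightSpace_congr (h : charDegree p q k l = charDegree p q k' l') :
    weightSpace p q k l = weightSpace p q k' l' := by
  ext f
  change IsWeightedHomogeneous _ _ _ ↔ IsWeightedHomogeneous _ _ _
  rw [h]

theorem swapVars_mem_weightSpace (hf : f ∈ weightSpace p q k l) :
    swapVars f ∈ weightSpace p q l k :=
  isWeightedHomogeneous_swapVars hf

theorem mul_mem_weightSpace (hz : z ∈ weightSpace p q k' l') (hf : f ∈ weightSpace p q k l) :
    z * f ∈ weightSpace p q (k + k') (l + l') := by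
  change IsWeightedHomogeneous _ _ _
  rw [charDegree_add, add_comm]
  exact IsWeightedHomogeneous.mul hz hf

theorem weightProj_mem (f : S) : weightProj p q k l f ∈ weightSpace p q k l :=
  weightedHomogeneousComponent_isWeightedHomogeneous _ f

theorem weightProj_of_mem (hf : f ∈ weightSpace p q k l) : weightProj p q k l f = f :=
  IsWeightedHomogeneous.weightedHomogeneousComponent_same hf

theorem weightProj_of_mem_of_ne (hf : f ∈ weightSpace p q k' l')
    (h : charDegree p q k l ≠ charDegree p q k' l') : weightProj p q k l f = 0 :=
  IsWeightedHomogeneous.weightedHomogeneousComponent_ne _ hf h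

theorem weightProj_mul (hz : z ∈ weightSpace p q k' l') (f : S) :
    weightProj p q (k + k') (l + l') (z * f) = z * weightProj p q k l f := by
  change weightedHomogeneousComponent _ _ _ = _
  rw [charDegree_add, add_comm]
  exact weightedHomogeneousComponent_mul_of_left hz _ f

theorem disjoint_weightSpace (h : charDegree p q k l ≠ charDegree p q k' l') :
    Disjoint (weightSpace p q k l) (weightSpace p q k' l') :=
  Submodule.disjoint_def.2 fun _ hf hf' =>
    (weightProj_of_mem hf).symm.trans (weightProj_of_mem_of_ne hf' h)

end WeightSpaces

section BoxRepresentations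

theorem eq_bot_or_eq_top_of_diag_of_swap {K : Type*} [Field K] {N : Submodule K (Fin 2 → K)}
    {c d ε : K} (hcd : c ≠ d) (hε : ε ≠ 0) (hdiag : ∀ w ∈ N, ![c * w 0, d * w 1] ∈ N)
    (hswap : ∀ w ∈ N, ![ε * w 1, ε * w 0] ∈ N) : N = ⊥ ∨ N = ⊤ := by
  refine or_iff_not_imp_left.2 fun hN => ?_
  obtain ⟨w, hw, hw0⟩ : ∃ w ∈ N, w 0 ≠ 0 := by
    by_contra! h
    refine hN ((Submodule.eq_bot_iff N).2 fun w hw => ?_)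
    have h1 : ε * w 1 = 0 := h _ (hswap w hw)
    ext i
    fin_cases i
    exacts [h w hw, (mul_eq_zero.1 h1).resolve_left hε]
  have hfst : ![1, 0] ∈ N := by
    convert N.smul_mem ((c - d) * w 0)⁻¹ (N.sub_mem (hdiag w hw) (N.smul_mem d hw)) using 1
    have hcd' := sub_ne_zero.2 hcd
    ext i
    fin_cases i
    · simp only [Fin.zero_eta, Matrix.cons_val_zero, Pi.smul_apply, Pi.sub_apply, smul_eq_mul]
      field_simp
    · simp only [Fin.mk_one, Matrix.cons_val_one, Matrix.cons_val_fin_one, Pi.smul_apply,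
        Pi.sub_apply, smul_eq_mul, sub_self, mul_zero]
  have hsnd : ![0, 1] ∈ N := by
    convert N.smul_mem ε⁻¹ (hswap _ hfst) using 1
    ext i
    fin_cases i <;> simp [hε]
  refine Submodule.eq_top_iff'.2 fun w => ?_
  convert N.add_mem (N.smul_mem (w 0) hfst) (N.smul_mem (w 1) hsnd) using 1
  ext i
  fin_cases i <;> simp

variable {p q : ℕ}

/-- The representation `ρ` of `G(pq, p, 2)` is given by the same formulas as `resBoxRep`, up to a
factor `ε` on the matrices that are not diagonal. This class contains the restrictions of `boxRep`
(with `ε = 1`) and is closed under twisting by the determinant. -/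
structure IsBoxType (ρ : Representation ℂ (planeGroup p q) (Fin 2 → ℂ)) (a b : ℕ) (ε : ℂ) :
    Prop where
  diag : ∀ {g : planeGroup p q} {u v : ℂ}, IsTorusPoint p q u v →
    ((g : GL (Fin 2) ℂ) : Matrix (Fin 2) (Fin 2) ℂ) = !![u, 0; 0, v] →
    ∀ w, ρ g w = ![u ^ a * v ^ b * w 0, u ^ b * v ^ a * w 1]
  antidiag : ∀ {g : planeGroup p q} {u v : ℂ}, IsTorusPoint p q u v →
    ((g : GL (Fin 2) ℂ) : Matrix (Fin 2) (Fin 2) ℂ) = !![0, v; u, 0] →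
    ∀ w, ρ g w = ![ε * (u ^ b * v ^ a * w 1), ε * (u ^ a * v ^ b * w 0)]

namespace IsBoxType

variable {ρ : Representation ℂ (planeGroup p q) (Fin 2 → ℂ)} {a b : ℕ} {ε : ℂ}

theorem detTwist (h : IsBoxType ρ a b ε) :
    IsBoxType (ReflectionMCM.detTwist _ ρ) (a + 1) (b + 1) (-ε) where
  diag {g u v} huv hg w := by
    change ((g : GL (Fin 2) ℂ) : Matrix (Fin 2) (Fin 2) ℂ).det • ρ g w = _
    rw [h.diag huv hg, hg, Matrix.det_fin_two_of, Matrix.smul_vec2, smul_eq_mul, smul_eq_mul]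
    exact Matrix.vec2_eq (by ring) (by ring)
  antidiag {g u v} huv hg w := by
    change ((g : GL (Fin 2) ℂ) : Matrix (Fin 2) (Fin 2) ℂ).det • ρ g w = _
    rw [h.antidiag huv hg, hg, Matrix.det_fin_two_of, Matrix.smul_vec2, smul_eq_mul, smul_eq_mul]
    exact Matrix.vec2_eq (by ring) (by ring)

variable [NeZero p] [NeZero q]

theorem isIrreducible (h : IsBoxType ρ a b ε) (hε : ε ≠ 0)
    (hab : charDegree p q a b ≠ charDegree p q b a) : ρ.IsIrreducible := by
  obtain ⟨u, v, huv, hne⟩ : ∃ u v : ℂ, IsTorusPoint p q u v ∧ u ^ a * v ^ b ≠ u ^ b * v ^ a := by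
    by_contra! heq
    exact hab (charDegree_eq_of_forall_isTorusPoint heq)
  obtain ⟨g, hgmem, hg⟩ := huv.exists_diag_mem
  obtain ⟨s, hsmem, hs⟩ := IsTorusPoint.one.exists_antidiag_mem (p := p) (q := q)
  have hnontrivial : Nontrivial (Subrepresentation ρ) :=
    ⟨⊥, ⊤, fun h => bot_ne_top (congrArg Subrepresentation.toSubmodule h)⟩
  refine @IsSimpleOrder.mk _ _ _ hnontrivial fun N => ?_
  have hN : N.toSubmodule = ⊥ ∨ N.toSubmodule = ⊤ :=
    eq_bot_or_eq_top_of_diag_of_swap hne hε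
      (fun w hw => h.diag (g := ⟨g, hgmem⟩) huv hg w ▸ N.apply_mem_toSubmodule _ hw)
      (fun w hw => by
        simpa [h.antidiag (g := ⟨s, hsmem⟩) .one hs w] using N.apply_mem_toSubmodule ⟨s, hsmem⟩ hw)
  exact hN.imp (fun h => Subrepresentation.toSubmodule_injective h)
    (fun h => Subrepresentation.toSubmodule_injective h)

theorem apply_mem_sup_weightSpace (h : IsBoxType ρ a b ε)
    (F : Representation.IntertwiningMap ρ (symRep (planeGroup p q))) (w : Fin 2 → ℂ) :
    F.toLinearMap w ∈ weightSpace p q a b ⊔ weightSpace p q b a := by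
  have hdiag {u v} (huv : IsTorusPoint p q u v) (w : Fin 2 → ℂ) :
      scaleVars u v (F.toLinearMap w) =
        F.toLinearMap ![u ^ a * v ^ b * w 0, u ^ b * v ^ a * w 1] := by
    obtain ⟨g, hgmem, hg⟩ := huv.exists_diag_mem
    rw [← h.diag (g := ⟨g, hgmem⟩) huv hg, ← symRep_of_eq_diag (g := ⟨g, hgmem⟩) hg]
    exact (LinearMap.congr_fun (F.isIntertwining' _) w).symm
  have hfst : F.toLinearMap ![w 0, 0] ∈ weightSpace p q a b :=
    mem_weightSpace_iff.2 fun u v huv => by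
      rw [hdiag huv, ← smul_eq_C_mul, ← map_smul]
      simp
  have hsnd : F.toLinearMap ![0, w 1] ∈ weightSpace p q b a :=
    mem_weightSpace_iff.2 fun u v huv => by
      rw [hdiag huv, ← smul_eq_C_mul, ← map_smul]
      simp
  have hw : w = ![w 0, 0] + ![0, w 1] := by
    ext i
    fin_cases i <;> simp
  rw [hw, map_add]
  exact Submodule.add_mem_sup hfst hsnd

/-- The equivariant map `ρ → S` that sends the two basis vectors to `f` and `ε * swapVars f`. -/
noncomputable def intertwiningMap (h : IsBoxType ρ a b ε) (hε : ε * ε = 1) {f : S}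
    (hf : f ∈ weightSpace p q a b) :
    Representation.IntertwiningMap ρ (symRep (planeGroup p q)) where
  toLinearMap :=
    (LinearMap.proj 0).smulRight f + (LinearMap.proj 1).smulRight (C ε * swapVars f)
  isIntertwining' g := by
    have hswap := swapVars_mem_weightSpace hf
    rw [mem_weightSpace_iff] at hf hswap
    have hCε : (C ε * C ε : S) = 1 := by rw [← map_mul, hε, map_one]
    refine LinearMap.ext fun w => ?_
    change ρ g w 0 • f + ρ g w 1 • (C ε * swapVars f) =
      symRep _ g (w 0 • f + w 1 • (C ε * swapVars f))
    simp only [smul_eq_C_mul]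
    obtain ⟨u, v, huv, hg | hg⟩ := exists_isTorusPoint_of_mem_planeGroup g.2
    · rw [symRep_of_eq_diag hg, h.diag huv hg]
      simp only [map_add, map_mul, scaleVars_C, hf u v huv, hswap u v huv, Matrix.cons_val_zero,
        Matrix.cons_val_one]
      ring
    · rw [symRep_of_eq_antidiag hg, h.antidiag huv hg]
      simp only [map_add, map_mul, scaleVars_C, swapVars_C, hf u v huv, hswap u v huv,
        Matrix.cons_val_zero, Matrix.cons_val_one, swapVars_swapVars]
      linear_combination C (u ^ a) * C (v ^ b) * C (w 0) * swapVars f * hCε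

theorem isotypic_eq (h : IsBoxType ρ a b ε) (hε : ε * ε = 1) :
    isotypic (planeGroup p q) ρ = weightSpace p q a b ⊔ weightSpace p q b a := by
  have mem_isotypic (F : Representation.IntertwiningMap ρ (symRep (planeGroup p q)))
      (w : Fin 2 → ℂ) : F.toLinearMap w ∈ isotypic (planeGroup p q) ρ :=
    Submodule.mem_iSup_of_mem (p := fun F : Representation.IntertwiningMap ρ _ =>
      LinearMap.range F.toLinearMap) F ⟨w, rfl⟩
  refine le_antisymm (fun f hf => ?_) (sup_le (fun f hf => ?_) fun f hf => ?_)
  · have hle : ⨆ F : Representation.IntertwiningMap ρ (symRep (planeGroup p q)),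
        LinearMap.range F.toLinearMap ≤
          (weightSpace p q a b ⊔ weightSpace p q b a).restrictScalars ℂ :=
      iSup_le fun F => LinearMap.range_le_iff_comap.2 (Submodule.eq_top_iff'.2 fun w =>
        h.apply_mem_sup_weightSpace F w)
    exact hle hf
  · convert mem_isotypic (h.intertwiningMap hε hf) ![1, 0] using 1
    simp [intertwiningMap]
  · convert mem_isotypic (h.intertwiningMap hε (swapVars_mem_weightSpace hf)) ![0, ε] using 1
    simp [intertwiningMap, smul_eq_C_mul, ← mul_assoc, ← map_mul, hε]

end IsBoxType

theorem isBoxType_resBoxRep [NeZero p] [NeZero q] (a b : ℕ) :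
    IsBoxType (resBoxRep (p * q) p a b) a b 1 where
  diag {g u v} huv hg w := by
    change Matrix.mulVec (boxMatrix a b ((g : GL (Fin 2) ℂ) : Matrix (Fin 2) (Fin 2) ℂ)) w = _
    rw [hg]
    ext i
    fin_cases i <;> simp [boxMatrix, Matrix.mulVec, dotProduct, huv.ne_zero_left,
      huv.ne_zero_right, mul_comm]
  antidiag {g u v} huv hg w := by
    change Matrix.mulVec (boxMatrix a b ((g : GL (Fin 2) ℂ) : Matrix (Fin 2) (Fin 2) ℂ)) w = _
    rw [hg]
    ext i
    fin_cases i <;> simp [boxMatrix, Matrix.mulVec, dotProduct, huv.ne_zero_left,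
      huv.ne_zero_right, mul_comm]

end BoxRepresentations

section QuotientModules

variable {R E : Type*} [CommRing R]

section Module

variable [AddCommGroup E] [Module R E]

theorem add_mem_sup_iff_of_disjoint {U U' A A' : Submodule R E} (hU : Disjoint U U') (hA : A ≤ U)
    (hA' : A' ≤ U') {u u' : E} (hu : u ∈ U) (hu' : u' ∈ U') :
    u + u' ∈ A ⊔ A' ↔ u ∈ A ∧ u' ∈ A' := by
  refine ⟨fun h => ?_, fun h => Submodule.add_mem_sup h.1 h.2⟩
  obtain ⟨a, ha, a', ha', hsum⟩ := Submodule.mem_sup.1 h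
  have hdiff : u - a = a' - u' := by
    rw [sub_eq_sub_iff_add_eq_add, ← hsum, add_comm]
  have hua : u - a = 0 := Submodule.disjoint_def.1 hU _ (U.sub_mem hu (hA ha))
    (hdiff ▸ U'.sub_mem (hA' ha') hu')
  exact ⟨sub_eq_zero.1 hua ▸ ha, sub_eq_zero.1 (hdiff.symm.trans hua) ▸ ha'⟩

/-- The quotient of an internal direct sum by a sum of submodules of the summands. -/
noncomputable def quotientSupEquiv {U U' A A' : Submodule R E} (hU : Disjoint U U') (hA : A ≤ U)
    (hA' : A' ≤ U') : (↥(U ⊔ U') ⧸ (A ⊔ A').comap (U ⊔ U').subtype) ≃ₗ[R]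
      (U ⧸ A.comap U.subtype) × (U' ⧸ A'.comap U'.subtype) :=
  let f := ((A ⊔ A').comap (U ⊔ U').subtype).mkQ ∘ₗ
    (Submodule.inclusion le_sup_left).coprod (Submodule.inclusion le_sup_right)
  let g := (A.comap U.subtype).mkQ.prodMap (A'.comap U'.subtype).mkQ
  have hf : Function.Surjective f := by
    refine (Submodule.mkQ_surjective _).comp ?_
    rintro ⟨x, hx⟩
    obtain ⟨u, hu, u', hu', rfl⟩ := Submodule.mem_sup.1 hx
    exact ⟨(⟨u, hu⟩, ⟨u', hu'⟩), rfl⟩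
  have hker : LinearMap.ker f = LinearMap.ker g := by
    ext ⟨u, u'⟩
    simp only [f, g, LinearMap.ker_prodMap, Submodule.ker_mkQ, LinearMap.mem_ker,
      LinearMap.comp_apply, Submodule.mkQ_apply, Submodule.Quotient.mk_eq_zero]
    exact add_mem_sup_iff_of_disjoint hU hA hA' u.2 u'.2
  (f.quotKerEquivOfSurjective hf).symm ≪≫ₗ Submodule.quotEquivOfEq _ _ hker ≪≫ₗ
    g.quotKerEquivOfSurjective
      ((Submodule.mkQ_surjective _).prodMap (Submodule.mkQ_surjective _))

/-- A linearly independent family identifies the quotients of its span with those of a free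
module. -/
noncomputable def quotientSpanEquiv {n : Type*} [Fintype n] {v : n → E}
    (hv : LinearIndependent R v) (B : Submodule R (n → R)) :
    (Submodule.span R (Set.range v) ⧸
        (B.map (Fintype.linearCombination R v)).comap (Submodule.span R (Set.range v)).subtype)
      ≃ₗ[R] (n → R) ⧸ B :=
  let e := LinearEquiv.ofInjective (Fintype.linearCombination R v)
      hv.fintypeLinearCombination_injective ≪≫ₗ
    LinearEquiv.ofEq _ _ (Fintype.range_linearCombination R v)
  (Submodule.Quotient.equiv B _ e (by
    ext x
    obtain ⟨y, rfl⟩ := e.surjective x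
    exact (Submodule.mem_map_equiv ..).trans ((by rw [e.symm_apply_apply] : _ ↔ y ∈ B).trans
      (hv.fintypeLinearCombination_injective.mem_set_image (s := (B : Set (n → R)))).symm))).symm

end Module

theorem map_mulLeft_span_range_eq [CommRing E] [Algebra R E] {n : Type*} [Fintype n] {z : E}
    {v w : n → E} {φ : Matrix n n R} {r : R} (hr : IsUnit r)
    (h : ∀ i, z * w i = r • ∑ l, φ l i • v l) :
    (Submodule.span R (Set.range w)).map (LinearMap.mulLeft R z) =
      (LinearMap.range φ.mulVecLin).map (Fintype.linearCombination R v) := by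
  rw [Matrix.range_mulVecLin, Submodule.map_span, Submodule.map_span, ← Set.range_comp,
    ← Set.range_comp, ← Submodule.span_smul_eq_of_isUnit (Set.range (_ ∘ φ.col)) r hr,
    Set.smul_set_range]
  exact congrArg _ (congrArg _ (_root_.funext h))

theorem IsMatrixFactorization.mk_comp_mem_range_iff {n : Type*} [Fintype n] [DecidableEq n] {D : R}
    {φ ψ : Matrix n n R} (h : IsMatrixFactorization D φ ψ) {v : n → R} :
    Ideal.Quotient.mk (Ideal.span {D}) ∘ v ∈
        LinearMap.range (φ.map (Ideal.Quotient.mk (Ideal.span {D}))).mulVecLin ↔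
      v ∈ LinearMap.range φ.mulVecLin := by
  constructor
  · rintro ⟨w, hw⟩
    obtain ⟨u, rfl⟩ := Ideal.Quotient.mk_surjective.comp_left w
    have hdvd (i : n) : D ∣ (v - φ.mulVec u) i := by
      rw [← Ideal.Quotient.eq_zero_iff_dvd, Pi.sub_apply, map_sub, RingHom.map_mulVec, sub_eq_zero]
      exact (congrFun hw i).symm
    choose c hc using hdvd
    refine ⟨u + ψ.mulVec c, ?_⟩
    rw [Matrix.mulVecLin_apply, Matrix.mulVec_add, Matrix.mulVec_mulVec, h.mul_eq,
      Matrix.smul_mulVec, Matrix.one_mulVec]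
    exact (sub_eq_iff_eq_add'.1 (_root_.funext hc)).symm
  · rintro ⟨u, rfl⟩
    exact ⟨Ideal.Quotient.mk _ ∘ u, _root_.funext fun i => (RingHom.map_mulVec _ _ _ i).symm⟩

/-- The cokernel of `φ` is already defined over `R ⧸ (D)` if `φ` is a factor of `D`. -/
noncomputable def IsMatrixFactorization.cokerEquiv {n : Type*} [Fintype n] [DecidableEq n] {D : R}
    {φ ψ : Matrix n n R} (h : IsMatrixFactorization D φ ψ) :
    ((n → R) ⧸ LinearMap.range φ.mulVecLin) ≃ₗ[R]
      ((n → R ⧸ Ideal.span {D}) ⧸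
        LinearMap.range (φ.map (Ideal.Quotient.mk (Ideal.span {D}))).mulVecLin) :=
  let f := (Submodule.mkQ (LinearMap.range
      (φ.map (Ideal.Quotient.mk (Ideal.span {D}))).mulVecLin)).restrictScalars R ∘ₗ
    (Ideal.Quotient.mkₐ R (Ideal.span {D})).toLinearMap.compLeft n
  have hf : Function.Surjective f :=
    (Submodule.mkQ_surjective _).comp (Ideal.Quotient.mk_surjective.comp_left)
  have hker : LinearMap.range φ.mulVecLin = LinearMap.ker f := by
    ext v
    exact h.mk_comp_mem_range_iff.symm.trans (Submodule.Quotient.mk_eq_zero _).symm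
  Submodule.quotEquivOfEq _ _ hker ≪≫ₗ f.quotKerEquivOfSurjective hf

end QuotientModules

section Splitting

theorem MMod.exists_comp_toQuotient_eq_id {n : ℕ} {G : Subgroup (GL (Fin n) ℂ)} {W : Type}
    [AddCommGroup W] [Module ℂ W] {ρ : Representation ℂ G W} {z : MvPolynomial (Fin n) ℂ}
    (P : MvPolynomial (Fin n) ℂ →ₗ[InvRing G] MvPolynomial (Fin n) ℂ)
    (hmem : ∀ f, P f ∈ isotypic G (detTwist G ρ))
    (hid : ∀ f ∈ isotypic G (detTwist G ρ), P f = f)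
    (hmul : ∀ f, P (z * f) ∈ (isotypic G ρ).map (LinearMap.mulLeft (InvRing G) z)) :
    ∃ π : (MvPolynomial (Fin n) ℂ ⧸ Ideal.span {z}) →ₗ[InvRing G] MMod G z ρ,
      π ∘ₗ MMod.toQuotient G z ρ = LinearMap.id := by
  let N := ((isotypic G ρ).map (LinearMap.mulLeft (InvRing G) z)).comap
    (isotypic G (detTwist G ρ)).subtype
  let P' := N.mkQ ∘ₗ P.codRestrict _ hmem
  have hker : (Ideal.span {z}).restrictScalars (InvRing G) ≤ LinearMap.ker P' := by
    intro f hf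
    obtain ⟨g, rfl⟩ := Ideal.mem_span_singleton.1 hf
    exact (Submodule.Quotient.mk_eq_zero N).2 (hmul g)
  refine ⟨Submodule.liftQ _ P' hker ∘ₗ
    (Submodule.Quotient.restrictScalarsEquiv (InvRing G) (Ideal.span {z})).symm.toLinearMap, ?_⟩
  ext x
  change N.mkQ (P.codRestrict _ hmem x) = N.mkQ x
  exact congrArg _ (Subtype.ext (hid x x.2))

variable {p q a b : ℕ}

theorem charDegree_succ_ne (hab : charDegree p q a b ≠ charDegree p q b a) :
    charDegree p q (a + 1) (b + 1) ≠ charDegree p q (b + 1) (a + 1) := by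
  rwa [charDegree_add, charDegree_add, Ne, add_left_inj]

variable [NeZero p] [NeZero q] {ρ : Representation ℂ (planeGroup p q) (Fin 2 → ℂ)} {ε : ℂ} {z : S}

theorem IsBoxType.exists_comp_toQuotient_eq_id (h : IsBoxType ρ a b ε) (hε : ε * ε = 1)
    (hab : charDegree p q a b ≠ charDegree p q b a) (hz : z ∈ weightSpace p q 1 1) :
    ∃ π : (S ⧸ Ideal.span {z}) →ₗ[PlaneInv p q] MMod (planeGroup p q) z ρ,
      π ∘ₗ MMod.toQuotient (planeGroup p q) z ρ = LinearMap.id := by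
  have hab' := charDegree_succ_ne hab
  refine MMod.exists_comp_toQuotient_eq_id
    (weightProj p q (a + 1) (b + 1) + weightProj p q (b + 1) (a + 1)) (fun f => ?_)
    (fun f hf => ?_) fun f => ?_
  · rw [h.detTwist.isotypic_eq (by rwa [neg_mul_neg])]
    exact Submodule.add_mem_sup (weightProj_mem f) (weightProj_mem f)
  · rw [h.detTwist.isotypic_eq (by rwa [neg_mul_neg])] at hf
    obtain ⟨f₁, hf₁, f₂, hf₂, rfl⟩ := Submodule.mem_sup.1 hf
    rw [LinearMap.add_apply, map_add, map_add, weightProj_of_mem hf₁, weightProj_of_mem hf₂,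
      weightProj_of_mem_of_ne hf₂ hab', weightProj_of_mem_of_ne hf₁ hab'.symm, add_zero, zero_add]
  · rw [h.isotypic_eq hε]
    refine ⟨weightProj p q a b f + weightProj p q b a f,
      Submodule.add_mem_sup (weightProj_mem f) (weightProj_mem f), ?_⟩
    rw [LinearMap.add_apply, weightProj_mul hz, weightProj_mul hz, ← mul_add]
    rfl

end Splitting

section WeightBases

/-- The family `v` is a basis of the `PlaneInv p q`-module `weightSpace p q k l`. -/
structure IsWeightBasis (p q : ℕ) [NeZero p] [NeZero q] {n : Type*} (v : n → S) (k l : ℕ) :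
    Prop where
  linearIndependent : LinearIndependent (PlaneInv p q) v
  span_eq : Submodule.span (PlaneInv p q) (Set.range v) = weightSpace p q k l

namespace IsWeightBasis

variable {p q : ℕ} [NeZero p] [NeZero q] {k l : ℕ}

theorem congr {n : Type*} {v : n → S} {k' l' : ℕ} (h : IsWeightBasis p q v k l)
    (hkl : charDegree p q k l = charDegree p q k' l') : IsWeightBasis p q v k' l' where
  linearIndependent := h.linearIndependent
  span_eq := h.span_eq.trans (weightSpace_congr hkl)

theorem neg_snd {f g : S} (h : IsWeightBasis p q ![f, g] k l) : IsWeightBasis p q ![f, -g] k l where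
  linearIndependent := LinearIndependent.pair_neg_right_iff.2 h.linearIndependent
  span_eq := by
    rw [← h.span_eq]
    simp only [Matrix.range_cons, Matrix.range_empty, Set.union_empty, Submodule.span_union,
      ← Set.neg_singleton, Submodule.span_neg]

theorem pair_swap {f g : S} (h : IsWeightBasis p q ![f, g] k l) :
    IsWeightBasis p q ![g, f] k l where
  linearIndependent := LinearIndependent.pair_symm_iff.1 h.linearIndependent
  span_eq := by
    rw [← h.span_eq, Matrix.range_cons_cons_empty, Matrix.range_cons_cons_empty, Set.pair_comm]

theorem swapVars_comp {n : Type*} {v : n → S} (h : IsWeightBasis p q v k l) :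
    IsWeightBasis p q (swapVars ∘ v) l k where
  linearIndependent := h.linearIndependent.map' (swapLinear p q) <| LinearMap.ker_eq_bot.2
    (Function.LeftInverse.injective swapVars_swapVars)
  span_eq := by
    rw [Set.range_comp]
    refine (Submodule.map_span (swapLinear p q) _).symm.trans ?_
    rw [h.span_eq]
    refine le_antisymm (Submodule.map_le_iff_le_comap.2 fun f => swapVars_mem_weightSpace)
      fun f hf => ⟨swapVars f, swapVars_mem_weightSpace hf, swapVars_swapVars f⟩

theorem nonempty_quotient_equiv {n : Type*} [Fintype n] {v w : n → S} {k' l' : ℕ} {z : S}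
    {φ : Matrix n n (PlaneInv p q)} {r : PlaneInv p q} (hv : IsWeightBasis p q v k l)
    (hw : IsWeightBasis p q w k' l') (hr : IsUnit r)
    (h : ∀ i, z * w i = r • ∑ j, φ j i • v j) :
    Nonempty ((weightSpace p q k l ⧸
      ((weightSpace p q k' l').map (LinearMap.mulLeft (PlaneInv p q) z)).comap
        (weightSpace p q k l).subtype) ≃ₗ[PlaneInv p q]
          (n → PlaneInv p q) ⧸ LinearMap.range φ.mulVecLin) := by
  rw [← hv.span_eq, ← hw.span_eq, map_mulLeft_span_range_eq hr h]
  exact ⟨quotientSpanEquiv hv.linearIndependent _⟩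

end IsWeightBasis

variable {p q : ℕ} [NeZero p] [NeZero q] {ρ : Representation ℂ (planeGroup p q) (Fin 2 → ℂ)}
  {a b : ℕ} {ε : ℂ} {z : S}

theorem IsBoxType.nonempty_mMod_equiv {n : Type*} [Fintype n] {v w : n → S}
    {φ : Matrix n n (PlaneInv p q)} {r : PlaneInv p q} (h : IsBoxType ρ a b ε)
    (hε : ε * ε = 1) (hab : charDegree p q a b ≠ charDegree p q b a)
    (hz : z ∈ weightSpace p q 1 1) (hswap : swapVars z = -z)
    (hv : IsWeightBasis p q v (a + 1) (b + 1)) (hw : IsWeightBasis p q w a b) (hr : IsUnit r)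
    (hφ : ∀ i, z * w i = r • ∑ j, φ j i • v j) :
    Nonempty (MMod (planeGroup p q) z ρ ≃ₗ[PlaneInv p q]
      ((n → PlaneInv p q) ⧸ LinearMap.range φ.mulVecLin) ×
        ((n → PlaneInv p q) ⧸ LinearMap.range φ.mulVecLin)) := by
  have hφ' (i : n) : z * (swapVars ∘ w) i = (-r) • ∑ j, φ j i • (swapVars ∘ v) j := by
    have hswapφ : swapVars (r • ∑ j, φ j i • v j) = r • ∑ j, φ j i • (swapVars ∘ v) j :=
      (map_smul (swapLinear p q) _ _).trans (by simp only [map_sum, map_smul]; rfl)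
    rw [neg_smul, ← hswapφ, ← hφ, map_mul, hswap, neg_mul, neg_neg]
    rfl
  obtain ⟨e⟩ := hv.nonempty_quotient_equiv hw hr hφ
  obtain ⟨e'⟩ := hv.swapVars_comp.nonempty_quotient_equiv hw.swapVars_comp hr.neg hφ'
  unfold MMod
  rw [h.isotypic_eq hε, h.detTwist.isotypic_eq (by rwa [neg_mul_neg]), Submodule.map_sup]
  refine ⟨quotientSupEquiv (disjoint_weightSpace (charDegree_succ_ne hab)) ?_ ?_ ≪≫ₗ
    e.prodCongr e'⟩ <;>
  exact Submodule.map_le_iff_le_comap.2 fun f hf => mul_mem_weightSpace hz hf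

theorem IsBoxType.givesSquareSummand {v w : Fin 2 → S}
    {φ ψ : Matrix (Fin 2) (Fin 2) (PlaneInv p q)} {D r : PlaneInv p q} (h : IsBoxType ρ a b ε)
    (hε : ε * ε = 1) (hab : charDegree p q a b ≠ charDegree p q b a)
    (hz : z ∈ weightSpace p q 1 1) (hswap : swapVars z = -z)
    (hv : IsWeightBasis p q v (a + 1) (b + 1)) (hw : IsWeightBasis p q w a b) (hr : IsUnit r)
    (hφ : ∀ i, z * w i = r • ∑ j, φ j i • v j) (hD : IsMatrixFactorization D φ ψ) :
    GivesSquareSummand (planeGroup p q) z ρ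
      (Coker (φ.map (Ideal.Quotient.mk (Ideal.span {D})))) := by
  obtain ⟨e⟩ := h.nonempty_mMod_equiv hε hab hz hswap hv hw hr hφ
  exact ⟨h.isIrreducible (left_ne_zero_of_mul_eq_one hε) hab,
    ⟨e ≪≫ₗ hD.cokerEquiv.prodCongr hD.cokerEquiv⟩, h.exists_comp_toQuotient_eq_id hε hab hz⟩

end WeightBases

section Matrices

variable {A B : Type} [CommRing A] [CommRing B] (f : A →+* B) {s t : A} {p j : ℕ}

theorem map_xiMat : (xiMat p s t j).map f = xiMat p (f s) (f t) j := by
  ext i l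
  fin_cases i <;> fin_cases l <;> simp [xiMat, map_ofNat f 2]

theorem map_phiMat : (phiMat p s t j).map f = phiMat p (f s) (f t) j := by
  ext i l
  fin_cases i <;> fin_cases l <;> simp [phiMat, map_ofNat f 2]

theorem map_psiMat : (psiMat p s t j).map f = psiMat p (f s) (f t) j := by
  ext i l
  fin_cases i <;> fin_cases l <;> simp [psiMat, map_ofNat f 2]

theorem isMatrixFactorization_xiMat (hj : j ≤ p + 1) :
    IsMatrixFactorization (s * (t ^ 2 - 4 * s ^ p)) (xiMat p s t j) (xiMat p s t j).adjugate := by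
  obtain ⟨l, hl⟩ := Nat.exists_eq_add_of_le hj
  convert isMatrixFactorization_adjugate (xiMat p s t j) using 1
  rw [xiMat, Matrix.det_fin_two_of, hl, Nat.add_sub_cancel_left]
  linear_combination (-4) * congrArg (s ^ ·) hl

theorem isMatrixFactorization_phiMat (hj : j ≤ p) :
    IsMatrixFactorization (s * (t ^ 2 - 4 * s ^ p)) (phiMat p s t j) (psiMat p s t j) := by
  obtain ⟨l, rfl⟩ := Nat.exists_eq_add_of_le hj
  have hl : j + l + 1 - j = l + 1 := by omega
  convert (isMatrixFactorization_adjugate (phiMat (j + l) s t j)).smul_right s using 1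
  · rw [phiMat, Matrix.det_fin_two_of, Nat.add_sub_cancel_left]
    ring
  · rw [psiMat, phiMat, Matrix.adjugate_fin_two_of, hl, Nat.add_sub_cancel_left]
    ext i l
    fin_cases i <;> fin_cases l <;> simp <;> ring

end Matrices

section Degrees

variable {p q : ℕ}

theorem charDegree_mul_add_ne_of_ne {i r j : ℕ} (hi : i < q) (hr : r < q) (hir : i ≠ r) :
    charDegree p q i (j * q + r) ≠ charDegree p q (j * q + r) i := by
  rw [Ne, charDegree_eq_iff]
  rintro ⟨h, -⟩
  have hdvd : (q : ℤ) ∣ i - r := by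
    have := dvd_add h (dvd_mul_left (q : ℤ) j)
    push_cast at this
    ring_nf at this ⊢
    exact this
  have := Int.eq_zero_of_abs_lt_dvd hdvd (by rw [abs_lt]; omega)
  omega

theorem charDegree_mul_add_ne_self {i j : ℕ} (hq : q ≠ 0) (hj0 : j ≠ 0) (hj : j < p)
    (hjp : 2 * j ≠ p) : charDegree p q i (j * q + i) ≠ charDegree p q (j * q + i) i := by
  rw [Ne, charDegree_eq_iff]
  rintro ⟨-, h⟩
  have hdvd : p * q ∣ 2 * j * q := by
    rw [← Int.natCast_dvd_natCast, ← dvd_neg]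
    push_cast at h ⊢
    ring_nf at h ⊢
    exact h
  obtain ⟨n, hn⟩ := (Nat.mul_dvd_mul_iff_right (Nat.pos_of_ne_zero hq)).1 hdvd
  rcases n with _ | _ | n
  · omega
  · omega
  · nlinarith

theorem charDegree_mul_add_ne {i r j : ℕ} (hi : i < q) (hr : r < q) (hj : j < p)
    (hjp : 2 * j ≠ p) (hij : i ≠ j * q + r) :
    charDegree p q i (j * q + r) ≠ charDegree p q (j * q + r) i := by
  rcases eq_or_ne i r with rfl | hir
  · exact charDegree_mul_add_ne_self (by omega) (by rintro rfl; omega) hj hjp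
  · exact charDegree_mul_add_ne_of_ne hi hr hir

end Degrees

section MonomialBases

variable {p q : ℕ} [NeZero p] [NeZero q]

theorem linearIndependent_X_pow {a b : ℕ} (hab : a + b ≠ 0) :
    LinearIndependent (PlaneInv p q) ![(X 0 ^ a : S), X 1 ^ b] := by
  refine LinearIndependent.pair_iff.2 fun r r' h => ?_
  have h₁ : InvRing.incl _ r * X 0 ^ a + InvRing.incl _ r' * X 1 ^ b = 0 := h
  have h₂ : InvRing.incl _ r * X 1 ^ a + InvRing.incl _ r' * X 0 ^ b = 0 := by
    simpa using congrArg swapVars h₁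
  have hr : InvRing.incl _ r * (X 0 ^ (a + b) - X 1 ^ (a + b)) = 0 := by
    linear_combination X 0 ^ b * h₁ - X 1 ^ b * h₂
  have hr' : InvRing.incl _ r' * (X 0 ^ (a + b) - X 1 ^ (a + b)) = 0 := by
    linear_combination X 0 ^ a * h₂ - X 1 ^ a * h₁
  have hne := pow_sub_pow_ne_zero (R := ℂ) hab
  exact ⟨(map_eq_zero_iff _ (InvRing.incl_injective _)).1 ((mul_eq_zero.1 hr).resolve_right hne),
    (map_eq_zero_iff _ (InvRing.incl_injective _)).1 ((mul_eq_zero.1 hr').resolve_right hne)⟩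

theorem isWeightBasis_monomials {c e j l : ℕ} (hc : c < q) (he : e < q) (hjl : j + l = p) :
    IsWeightBasis p q ![X 0 ^ c * X 1 ^ e * X 0 ^ (l * q), X 0 ^ c * X 1 ^ e * X 1 ^ (j * q)]
      c (j * q + e) where
  linearIndependent := by
    have hne : l * q + j * q ≠ 0 := by
      rw [← add_mul, add_comm, hjl]
      exact NeZero.ne _
    have hinj : Function.Injective (LinearMap.mulLeft (PlaneInv p q) (X 0 ^ c * X 1 ^ e : S)) :=
      mul_right_injective₀ (mul_ne_zero (pow_ne_zero _ (X_ne_zero _)) (pow_ne_zero _ (X_ne_zero _)))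
    have h := (linearIndependent_X_pow hne).map' _ (LinearMap.ker_eq_bot.2 hinj)
    have hcomp : ⇑(LinearMap.mulLeft (PlaneInv p q) (X 0 ^ c * X 1 ^ e : S)) ∘
        ![X 0 ^ (l * q), X 1 ^ (j * q)] =
          ![X 0 ^ c * X 1 ^ e * X 0 ^ (l * q), X 0 ^ c * X 1 ^ e * X 1 ^ (j * q)] :=
      _root_.funext (Fin.forall_fin_two.2 ⟨rfl, rfl⟩)
    rwa [hcomp] at h
  span_eq := by
    subst hjl
    rw [Matrix.range_cons_cons_empty]
    refine le_antisymm (Submodule.span_le.2 (Set.pair_subset ?_ ?_)) fun f hf => ?_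
    · have hdeg : charDegree (j + l) q (c + l * q) e = charDegree (j + l) q c (j * q + e) := by
        rw [charDegree_eq_iff]
        push_cast
        exact ⟨⟨l, by ring⟩, ⟨1, by ring⟩⟩
      have h := X_pow_mul_X_pow_mem_weightSpace (p := j + l) (q := q) (k := c + l * q) (l := e)
      rwa [pow_add, mul_right_comm, weightSpace_congr hdeg] at h
    · have h := X_pow_mul_X_pow_mem_weightSpace (p := j + l) (q := q) (k := c) (l := j * q + e)
      rwa [pow_add, mul_comm (X 1 ^ (j * q)), ← mul_assoc] at h
    · have h := mem_span_of_isWeightedHomogeneous ⟨sigmaOne (j + l) q, rfl⟩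
        ⟨sigmaTwo (j + l) q, rfl⟩ hc he (Nat.le_add_right j l) hf
      rwa [Nat.add_sub_cancel_left] at h

end MonomialBases

section Families

theorem swapVars_arrangement (n : ℕ) (k : ℂ) :
    swapVars (C k * (X 0 * X 1 * (X 0 ^ n - X 1 ^ n))) =
    -(C k * (X 0 * X 1 * (X 0 ^ n - X 1 ^ n))) := by
  simp only [map_mul, map_sub, map_pow, swapVars_C, swapVars_X_zero, swapVars_X_one]
  ring

variable {p q : ℕ} [NeZero p] [NeZero q] {k : ℂ} {D : PlaneInv p q}

theorem arrangement_mem_weightSpace (k : ℂ) :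
    C k * (X 0 * X 1 * (X 0 ^ (p * q) - X 1 ^ (p * q))) ∈ weightSpace p q 1 1 := by
  have hx : charDegree p q (p * q) 0 = charDegree p q 0 0 := by
    rw [charDegree_eq_iff]
    push_cast
    exact ⟨⟨p, by ring⟩, ⟨1, by ring⟩⟩
  have hy : charDegree p q 0 (p * q) = charDegree p q 0 0 := by
    rw [charDegree_eq_iff]
    push_cast
    exact ⟨⟨0, by ring⟩, ⟨-1, by ring⟩⟩
  have hxm : (X 0 ^ (p * q) : S) ∈ weightSpace p q 0 0 := by
    rw [← weightSpace_congr hx, ← mul_one (X 0 ^ _), ← pow_zero (X 1)]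
    exact X_pow_mul_X_pow_mem_weightSpace
  have hym : (X 1 ^ (p * q) : S) ∈ weightSpace p q 0 0 := by
    rw [← weightSpace_congr hy, ← one_mul (X 1 ^ _), ← pow_zero (X 0)]
    exact X_pow_mul_X_pow_mem_weightSpace
  have hxy : (X 0 * X 1 : S) ∈ weightSpace p q 1 1 := by
    rw [← pow_one (X 0), ← pow_one (X 1)]
    exact X_pow_mul_X_pow_mem_weightSpace
  rw [← smul_eq_C_mul]
  exact Submodule.smul_of_tower_mem _ k (mul_mem_weightSpace hxy (Submodule.sub_mem _ hxm hym))

theorem givesSquareSummand_resBoxRep {a b : ℕ} {v w : Fin 2 → S}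
    {φ ψ : Matrix (Fin 2) (Fin 2) (PlaneInv p q)} (hk : k ≠ 0)
    (hab : charDegree p q a b ≠ charDegree p q b a) (hv : IsWeightBasis p q v (a + 1) (b + 1))
    (hw : IsWeightBasis p q w a b) (hD : IsMatrixFactorization D φ ψ)
    (hφ : ∀ i, X 0 * X 1 * (X 0 ^ (p * q) - X 1 ^ (p * q)) * w i =
      InvRing.incl _ (φ 0 i) * v 0 + InvRing.incl _ (φ 1 i) * v 1) :
    GivesSquareSummand (planeGroup p q) (C k * (X 0 * X 1 * (X 0 ^ (p * q) - X 1 ^ (p * q))))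
      (resBoxRep (p * q) p a b) (Coker (φ.map (Ideal.Quotient.mk (Ideal.span {D})))) := by
  refine (isBoxType_resBoxRep a b).givesSquareSummand (one_mul 1) hab
    (arrangement_mem_weightSpace k) (swapVars_arrangement _ k) hv hw
    (hk.isUnit.map (algebraMap ℂ (PlaneInv p q))) (fun i => ?_) hD
  rw [algebraMap_smul, smul_eq_C_mul, mul_assoc, hφ, Fin.sum_univ_two]
  rfl

theorem givesSquareSummand_xMod (hk : k ≠ 0) (hD : sigmaDisc p q ∣ D) {i j : ℕ} (hj0 : j ≠ 0)
    (hj : j ≤ p) (hi : i < q - 1) :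
    GivesSquareSummand (planeGroup p q) (C k * (X 0 * X 1 * (X 0 ^ (p * q) - X 1 ^ (p * q))))
      (resBoxRep (p * q) p i (j * q - 1))
      (XMod p (Ideal.Quotient.mk (Ideal.span {D}) (sigmaOne p q))
        (Ideal.Quotient.mk (Ideal.span {D}) (sigmaTwo p q)) (p + 1 - j)) := by
  obtain ⟨ψ, hψ⟩ := (isMatrixFactorization_xiMat (s := sigmaOne p q) (t := sigmaTwo p q)
    (Nat.sub_le (p + 1) j)).exists_of_dvd hD
  obtain ⟨j, rfl⟩ := Nat.exists_eq_add_one_of_ne_zero hj0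
  obtain ⟨l, rfl⟩ := Nat.exists_eq_add_of_le hj
  obtain ⟨q, rfl⟩ := Nat.exists_eq_add_one_of_ne_zero (NeZero.ne q)
  have hl : j + 1 + l + 1 - (j + 1) = l + 1 := by omega
  have hj' : j + 1 + l + 1 - (l + 1) = j + 1 := by omega
  have hb : (j + 1) * (q + 1) - 1 = j * (q + 1) + q := by rw [add_mul]; omega
  have hb' : (j + 1) * (q + 1) + 0 = j * (q + 1) + q + 1 := by ring
  have hv := isWeightBasis_monomials (show i + 1 < q + 1 by omega) q.succ_pos
    (show j + 1 + l = j + 1 + l from rfl)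
  have hw := isWeightBasis_monomials (show i < q + 1 by omega) q.lt_succ_self
    (show j + (l + 1) = j + 1 + l by omega)
  rw [hb'] at hv
  rw [hl] at hψ
  unfold XMod
  rw [hb, hl, ← map_xiMat]
  refine givesSquareSummand_resBoxRep hk (charDegree_mul_add_ne_of_ne (by omega) (by omega)
    (by omega)) hv.neg_snd.pair_swap hw.pair_swap hψ ?_
  simp only [Fin.forall_fin_two, xiMat, hj', Matrix.of_apply, Matrix.cons_val',
    Matrix.cons_val_zero, Matrix.cons_val_one, Matrix.cons_val_fin_one, map_mul, map_pow, map_ofNat,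
    incl_sigmaOne, incl_sigmaTwo]
  constructor <;> ring

theorem givesSquareSummand_kMod (hk : k ≠ 0) (hD : sigmaDisc p q ∣ D) {i j r : ℕ} (hj : j < p)
    (hjp : 2 * j ≠ p) (hi : i < q - 1) (hr : r < q - 1) (hij : i ≠ j * q + r) :
    GivesSquareSummand (planeGroup p q) (C k * (X 0 * X 1 * (X 0 ^ (p * q) - X 1 ^ (p * q))))
      (resBoxRep (p * q) p i (j * q + r))
      (KMod p (Ideal.Quotient.mk (Ideal.span {D}) (sigmaOne p q))
        (Ideal.Quotient.mk (Ideal.span {D}) (sigmaTwo p q)) j) := by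
  obtain ⟨ψ, hψ⟩ := (isMatrixFactorization_phiMat (s := sigmaOne p q) (t := sigmaTwo p q)
    hj.le).exists_of_dvd hD
  obtain ⟨l, rfl⟩ := Nat.exists_eq_add_of_le hj.le
  have hv := isWeightBasis_monomials (show i + 1 < q by omega) (show r + 1 < q by omega)
    (show j + l = j + l from rfl)
  have hw := isWeightBasis_monomials (show i < q by omega) (show r < q by omega)
    (show j + l = j + l from rfl)
  unfold KMod
  rw [← map_phiMat]
  refine givesSquareSummand_resBoxRep hk (charDegree_mul_add_ne (by omega) (by omega) hj hjp hij)
    hv.neg_snd hw hψ ?_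
  simp only [Fin.forall_fin_two, phiMat, Nat.add_sub_cancel_left, Matrix.of_apply, Matrix.cons_val',
    Matrix.cons_val_zero, Matrix.cons_val_one, Matrix.cons_val_fin_one, map_mul, map_pow, map_ofNat,
    incl_sigmaOne, incl_sigmaTwo]
  constructor <;> ring

theorem givesSquareSummand_nMod (hk : k ≠ 0) (hD : sigmaDisc p q ∣ D) {j : ℕ} (hj0 : j ≠ 0)
    (hj : j < p) (hjp : 2 * j ≠ p) :
    GivesSquareSummand (planeGroup p q) (C k * (X 0 * X 1 * (X 0 ^ (p * q) - X 1 ^ (p * q))))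
      (resBoxRep (p * q) p (q - 1) ((j + 1) * q - 1))
      (NMod p (Ideal.Quotient.mk (Ideal.span {D}) (sigmaOne p q))
        (Ideal.Quotient.mk (Ideal.span {D}) (sigmaTwo p q)) j) := by
  obtain ⟨φ, hφ⟩ := (isMatrixFactorization_phiMat (s := sigmaOne p q) (t := sigmaTwo p q)
    hj.le).symm.exists_of_dvd hD
  obtain ⟨l, rfl⟩ := Nat.exists_eq_add_of_le hj.le
  obtain ⟨q, rfl⟩ := Nat.exists_eq_add_one_of_ne_zero (NeZero.ne q)
  have hl : j + l + 1 - j = l + 1 := by omega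
  have hb : (j + 1) * (q + 1) - 1 = j * (q + 1) + q := by rw [add_mul]; omega
  have hdeg : charDegree (j + l) (q + 1) 0 (j * (q + 1) + 0) =
      charDegree (j + l) (q + 1) (q + 1) (j * (q + 1) + q + 1) := by
    rw [charDegree_eq_iff]
    push_cast
    exact ⟨⟨-1, by ring⟩, ⟨0, by ring⟩⟩
  have hv := (isWeightBasis_monomials (show 0 < q + 1 by omega) (show 0 < q + 1 by omega)
    (show j + l = j + l from rfl)).congr hdeg
  have hw := isWeightBasis_monomials (show q < q + 1 by omega) (show q < q + 1 by omega)
    (show j + l = j + l from rfl)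
  unfold NMod
  rw [hb, Nat.add_sub_cancel, ← map_psiMat]
  refine givesSquareSummand_resBoxRep hk (charDegree_mul_add_ne_self q.succ_ne_zero hj0 hj hjp)
    hv hw.neg_snd hφ ?_
  simp only [Fin.forall_fin_two, psiMat, hl, Matrix.of_apply, Matrix.cons_val',
    Matrix.cons_val_zero, Matrix.cons_val_one, Matrix.cons_val_fin_one, map_mul, map_neg, map_pow,
    map_ofNat, incl_sigmaOne, incl_sigmaTwo]
  constructor <;> ring

end Families

section CohenMacaulayFamilies

variable {p q : ℕ} [NeZero p] [NeZero q] {D : PlaneInv p q} {j : ℕ}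

theorem isCohenMacaulayModule_xMod (hD : sigmaDisc p q ∣ D) (hD0 : D ≠ 0) (hj : j ≤ p + 1) :
    IsCohenMacaulayModule (PlaneInv p q ⧸ Ideal.span {D})
      (XMod p (Ideal.Quotient.mk (Ideal.span {D}) (sigmaOne p q))
        (Ideal.Quotient.mk (Ideal.span {D}) (sigmaTwo p q)) j) := by
  obtain ⟨ψ, h⟩ := (isMatrixFactorization_xiMat hj).exists_of_dvd hD
  unfold XMod
  rw [← map_xiMat]
  exact h.isCohenMacaulayModule_coker hD0 ringKrullDim_planeInv.le

theorem isCohenMacaulayModule_kMod (hD : sigmaDisc p q ∣ D) (hD0 : D ≠ 0) (hj : j ≤ p) :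
    IsCohenMacaulayModule (PlaneInv p q ⧸ Ideal.span {D})
      (KMod p (Ideal.Quotient.mk (Ideal.span {D}) (sigmaOne p q))
        (Ideal.Quotient.mk (Ideal.span {D}) (sigmaTwo p q)) j) := by
  obtain ⟨ψ, h⟩ := (isMatrixFactorization_phiMat hj).exists_of_dvd hD
  unfold KMod
  rw [← map_phiMat]
  exact h.isCohenMacaulayModule_coker hD0 ringKrullDim_planeInv.le

theorem isCohenMacaulayModule_nMod (hD : sigmaDisc p q ∣ D) (hD0 : D ≠ 0) (hj : j ≤ p) :
    IsCohenMacaulayModule (PlaneInv p q ⧸ Ideal.span {D})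
      (NMod p (Ideal.Quotient.mk (Ideal.span {D}) (sigmaOne p q))
        (Ideal.Quotient.mk (Ideal.span {D}) (sigmaTwo p q)) j) := by
  obtain ⟨ψ, h⟩ := (isMatrixFactorization_phiMat hj).symm.exists_of_dvd hD
  unfold NMod
  rw [← map_psiMat]
  exact h.isCohenMacaulayModule_coker hD0 ringKrullDim_planeInv.le

end CohenMacaulayFamilies

theorem exists_aeval_sigma_eq_smul_sigmaDisc {p q : ℕ} [NeZero p] [NeZero q] (hp : 2 ≤ p) {c : ℂ}
    (hc : c ≠ 0) :
    ∃ F : MvPolynomial (Fin 2) ℂ, aeval ![sigmaOne p q, sigmaTwo p q] F = c • sigmaDisc p q ∧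
      IsDSingularity (p + 2) (F : MvPowerSeries (Fin 2) ℂ) := by
  refine ⟨_, ?_, isDSingularity_mul_sq_sub_pow hp (by norm_num : (4 : ℂ) ≠ 0) hc⟩
  simp [sigmaDisc, Algebra.smul_def, map_ofNat (algebraMap ℂ (PlaneInv p q)) 4]

end ReflectionMCM

theorem mainTheorem6_general {p q : ℕ} (hp : 2 ≤ p) (hq : 2 ≤ q)
    (α : Submodule ℂ (Fin 2 → ℂ) → MvPolynomial (Fin 2) ℂ)
    (hα : ∀ H ∈ reflectingHyperplanes (imprimitiveGroup (p * q) p 2), IsDefiningForm H (α H)) :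
    ∃ σ₁ σ₂ Δ : InvRing (imprimitiveGroup (p * q) p 2),
      InvRing.incl _ σ₁ = (X 0 * X 1) ^ q ∧
      InvRing.incl _ σ₂ = X 0 ^ (p * q) + X 1 ^ (p * q) ∧
      AlgebraicIndependent ℂ ![σ₁, σ₂] ∧
      Algebra.adjoin ℂ {σ₁, σ₂} = ⊤ ∧
      InvRing.incl _ Δ = discriminantPoly (imprimitiveGroup (p * q) p 2) α ∧
      (∃ c : ℂ, c ≠ 0 ∧ Δ = c • (σ₁ * (σ₂ ^ 2 - 4 * σ₁ ^ p))) ∧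
      (∃ F : MvPolynomial (Fin 2) ℂ, aeval ![σ₁, σ₂] F = Δ ∧
        IsDSingularity (p + 2) (F : MvPowerSeries (Fin 2) ℂ)) ∧
      ∃ s t : InvRing (imprimitiveGroup (p * q) p 2) ⧸ Ideal.span {Δ},
        s = Ideal.Quotient.mk _ σ₁ ∧ t = Ideal.Quotient.mk _ σ₂ ∧
        (∀ j ≤ p,
          IsCohenMacaulayModule (InvRing (imprimitiveGroup (p * q) p 2) ⧸ Ideal.span {Δ})
            (XMod p s t j) ∧
          IsCohenMacaulayModule (InvRing (imprimitiveGroup (p * q) p 2) ⧸ Ideal.span {Δ})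
            (KMod p s t j) ∧
          IsCohenMacaulayModule (InvRing (imprimitiveGroup (p * q) p 2) ⧸ Ideal.span {Δ})
            (NMod p s t j)) ∧
        (∀ i j : ℕ, j ≠ 0 → j ≤ p → i < q - 1 →
          GivesSquareSummand (imprimitiveGroup (p * q) p 2)
            (arrangementPoly (imprimitiveGroup (p * q) p 2) α)
            (resBoxRep (p * q) p i (j * q - 1)) (XMod p s t (p + 1 - j))) ∧
        (∀ i j r : ℕ, j < p → 2 * j ≠ p → i < q - 1 → r < q - 1 → i ≠ j * q + r →
          GivesSquareSummand (imprimitiveGroup (p * q) p 2)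
            (arrangementPoly (imprimitiveGroup (p * q) p 2) α)
            (resBoxRep (p * q) p i (j * q + r)) (KMod p s t j)) ∧
        (∀ j : ℕ, j ≠ 0 → j < p → 2 * j ≠ p →
          GivesSquareSummand (imprimitiveGroup (p * q) p 2)
            (arrangementPoly (imprimitiveGroup (p * q) p 2) α)
            (resBoxRep (p * q) p (q - 1) ((j + 1) * q - 1)) (NMod p s t j)) := by
  have : NeZero p := ⟨by omega⟩
  have : NeZero q := ⟨by omega⟩
  obtain ⟨k, hk, hz⟩ := exists_arrangementPoly_eq hq hα
  obtain ⟨c, hc, hdisc⟩ := exists_discriminantPoly_eq hq hα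
  have hD : sigmaDisc p q ∣ c • sigmaDisc p q := dvd_smul_of_dvd c dvd_rfl
  have hD0 : c • sigmaDisc p q ≠ 0 := smul_ne_zero hc sigmaDisc_ne_zero
  refine ⟨sigmaOne p q, sigmaTwo p q, c • sigmaDisc p q, incl_sigmaOne, incl_sigmaTwo,
    algebraicIndependent_sigma, adjoin_sigma_eq_top, ?_, ⟨c, hc, rfl⟩,
    exists_aeval_sigma_eq_smul_sigmaDisc hp hc, _, _, rfl, rfl, fun j hj =>
    ⟨isCohenMacaulayModule_xMod hD hD0 (by omega), isCohenMacaulayModule_kMod hD hD0 hj,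
      isCohenMacaulayModule_nMod hD hD0 hj⟩, ?_⟩
  · rw [map_smul, smul_eq_C_mul]
    exact hdisc.symm
  · rw [hz]
    exact ⟨fun i j hj0 hj hi => givesSquareSummand_xMod hk hD hj0 hj hi,
      fun i j r hj hjp hi hr hij => givesSquareSummand_kMod hk hD hj hjp hi hr hij,
      fun j hj0 hj hjp => givesSquareSummand_nMod hk hD hj0 hj hjp⟩

theorem mainTheorem6 (m p q : ℕ) (hm : 0 < m) (hmpq : m = p * q) (hp : Even p) (hne : m ≠ p)
    (α : Submodule ℂ (Fin 2 → ℂ) → MvPolynomial (Fin 2) ℂ)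
    (hα : ∀ H ∈ reflectingHyperplanes (imprimitiveGroup m p 2), IsDefiningForm H (α H)) :
    ∃ σ₁ σ₂ Δ : InvRing (imprimitiveGroup m p 2),
      -- basic invariants
      InvRing.incl _ σ₁ = (X 0 * X 1) ^ q ∧
      InvRing.incl _ σ₂ = X 0 ^ m + X 1 ^ m ∧
      AlgebraicIndependent ℂ ![σ₁, σ₂] ∧
      Algebra.adjoin ℂ {σ₁, σ₂} = ⊤ ∧
      -- the discriminant, and its type as a plane curve singularity
      InvRing.incl _ Δ = discriminantPoly (imprimitiveGroup m p 2) α ∧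
      (∃ c : ℂ, c ≠ 0 ∧ Δ = c • (σ₁ * (σ₂ ^ 2 - 4 * σ₁ ^ p))) ∧
      (∃ F : MvPolynomial (Fin 2) ℂ, aeval ![σ₁, σ₂] F = Δ ∧
        IsDSingularity (p + 2) (F : MvPowerSeries (Fin 2) ℂ)) ∧
      ∃ s t : InvRing (imprimitiveGroup m p 2) ⧸ Ideal.span {Δ},
        s = Ideal.Quotient.mk _ σ₁ ∧ t = Ideal.Quotient.mk _ σ₂ ∧
        -- the modules are Cohen-Macaulay over `R/(Δ)`
        (∀ j ≤ p,
          IsCohenMacaulayModule (InvRing (imprimitiveGroup m p 2) ⧸ Ideal.span {Δ})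
            (XMod p s t j) ∧
          IsCohenMacaulayModule (InvRing (imprimitiveGroup m p 2) ⧸ Ideal.span {Δ})
            (KMod p s t j) ∧
          IsCohenMacaulayModule (InvRing (imprimitiveGroup m p 2) ⧸ Ideal.span {Δ})
            (NMod p s t j)) ∧
        -- the `X` family
        (∀ i j : ℕ, 1 ≤ j → j ≤ p → i < q - 1 →
          GivesSquareSummand (imprimitiveGroup m p 2)
            (arrangementPoly (imprimitiveGroup m p 2) α)
            (resBoxRep m p i (j * q - 1)) (XMod p s t (p + 1 - j))) ∧
        -- the `K` family
        (∀ i j r : ℕ, j ≤ p - 1 → j ≠ p / 2 → i < q - 1 → r < q - 1 → i < j * q + r →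
          GivesSquareSummand (imprimitiveGroup m p 2)
            (arrangementPoly (imprimitiveGroup m p 2) α)
            (resBoxRep m p i (j * q + r)) (KMod p s t j)) ∧
        -- the `N` family
        (∀ j : ℕ, 1 ≤ j → j ≤ p - 1 → j ≠ p / 2 →
          GivesSquareSummand (imprimitiveGroup m p 2)
            (arrangementPoly (imprimitiveGroup m p 2) α)
            (resBoxRep m p (q - 1) ((j + 1) * q - 1)) (NMod p s t j)) := by
  subst hmpq
  obtain ⟨n, rfl⟩ := hp
  obtain ⟨hn, hq⟩ : n ≠ 0 ∧ q ≠ 0 := ⟨by rintro rfl; simp at hm, by rintro rfl; simp at hm⟩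
  have hq1 : q ≠ 1 := by rintro rfl; exact hne (mul_one _)
  obtain ⟨σ₁, σ₂, Δ, h₁, h₂, halg, htop, hdisc, hΔ, hsing, s, t, hs, ht, hCM, hX, hK, hN⟩ :=
    mainTheorem6_general (p := n + n) (q := q) (by omega) (by omega) α hα
  exact ⟨σ₁, σ₂, Δ, h₁, h₂, halg, htop, hdisc, hΔ, hsing, s, t, hs, ht, hCM,
    fun i j hj0 hj hi => hX i j (by omega) hj hi,
    fun i j r hj hjp hi hr hij => hK i j r (by omega) (by omega) hi hr hij.ne,
    fun j hj0 hj hjp => hN j (by omega) (by omega) (by omega)⟩
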